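/- Let $k$ be a field of characteristic $0$ which is henselian with respect to a discrete valuation $v$ with perfect residue field $k_0$. Let $k^s$ be a separable closure of $k$, $\mathcal O^s$ the integral closure of the valuation ring in $k^s$, and $k_0^s$ its residue field (a separable closure of $k_0$). Put $\Gamma_k=\mathrm{Gal}(k^s/k)$ and $\Gamma_{k_0}=\mathrm{Gal}(k_0^s/k_0)$. Let $\Gamma_k^t$ be the maximal tame quotient of $\Gamma_k$, i.e. the quotient by wild inertia, and let $I^t=\ker(\Gamma_k^t\to\Gamma_{k_0})$ be the tame inertia group. Fix a continuous section of $\Gamma_k^t\to\Gamma_{k_0}$, so that $\Gamma_k^t=I^t\rtimes\Gamma_{k_0}$, and a topological generator $q_0$ of $I^t$. Let $\chi$ be the cyclotomic character of $k_0$ (on roots of unity of order prime to $\mathrm{char}\,k_0$). Let $G$ be a finite group with center $C$ and $\bar G=G/C$. Let $\bar\phi:\Gamma_k\to\bar G$ be a continuous homomorphism (for example, the one attached to a $G$-cover of $\mathbb P^1_{k^s}$ with field of moduli $k$). Let $\omega\in H^2(k,C)$ be the obstruction to lifting $\bar\phi$ to $G$, i.e. the class of $(\sigma,\tau)\mapsto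 h_\sigma h_\tau h_{\sigma\tau}^{-1}$ for any continuous set-theoretic lift $h$ of $\bar\phi$; here $C$ is a constant module. Assume that the order of $C$ is prime to the characteristic of $k_0$ (no condition if this is $0$) and that $\bar\phi$ is trivial on wild inertia; we regard $\bar\phi$ as a homomorphism on $\Gamma_k^t$. Let $C(-1)=\mathrm{Hom}(I^t,C)$ be the group of continuous homomorphisms, with the action $(\sigma\cdot\eta)(q)=\eta(\sigma^{-1}q\sigma)$ of $\Gamma_{k_0}$. Let $r_v:H^2(k,C)\to H^1(k_0,C(-1))$ be the residue map: if a class is represented by the inflation of a normalized continuous $2$-cocycle $a$ on $\Gamma_k^t$ such that $a(\tau_1,\tau_2)$ depends on $\tau_2$ only through its image in $\Gamma_{k_0}$, then its residue is the class of $\sigma\mapsto(q\mapsto a(q,\sigma))$. Let $a_0\in G$ be a lift of $\bar\phi(q_0)$. For $\sigma\in\Gamma_{k_0}$ and $g\in G$ put ${}^\sigma g=\bar\phi(\sigma)\,g\,\bar\phi(\sigma)^{-1}$, and let $$c_\sigma:=a_0\,({}^\sigma a_0)^{-\chi(\sigma)^{-1}}.$$ (i) The map $C(-1)\to C$, $\eta\mapsto\eta(q_0)$,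 is bijective. Each $c_\sigma$ lies in $C$, and under this identification $\sigma\mapsto c_\sigma$ is a continuous $1$-cocycle of $\Gamma_{k_0}$ with values in $C(-1)$. Its class in $H^1(k_0,C(-1))$ equals $r_v(\omega)$. (ii) If $r_v(\omega)=0$, then there is exactly one class $\omega_0\in H^2(k_0,C)$ whose inflation to $H^2(k,C)$ is $\omega$. This $\omega_0$ is the obstruction to lifting $\bar\phi_0:=\bar\phi|_{\Gamma_{k_0}}$ to $G$; in particular, $\omega_0=0$ if and only if $\bar\phi_0$ lifts to a continuous homomorphism $\Gamma_{k_0}\to G$. -/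

import Mathlib

noncomputable section

namespace TameResidue

open IsLocalRing
open scoped Pointwise

/-! ### Continuous cohomology in low degrees

Cohomology of a topological group `Γ` is computed by continuous inhomogeneous cochains.
Coefficient groups are written multiplicatively, so the zero class is `1`. -/

section Cohomology

variable {Γ A : Type*} [Group Γ] [TopologicalSpace Γ] [CommGroup A] [TopologicalSpace A]
  [IsTopologicalGroup A]

/-- Continuous `1`-cocycles with values in the `Γ`-module `A` (action `ρ`). -/
def Z1 (ρ : Γ →* MulAut A) : Subgroup (Γ → A) where
  carrier := {c | Continuous c ∧ ∀ g h, c (g * h) = c g * ρ g (c h)}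
  one_mem' := ⟨continuous_const, fun g h => by simp⟩
  mul_mem' := by
    rintro c d ⟨hc, hc'⟩ ⟨hd, hd'⟩
    refine ⟨hc.mul hd, fun g h => ?_⟩
    simp only [Pi.mul_apply, hc', hd', map_mul]
    exact mul_mul_mul_comm _ _ _ _
  inv_mem' := by
    rintro c ⟨hc, hc'⟩
    refine ⟨hc.inv, fun g h => ?_⟩
    simp only [Pi.inv_apply, hc', map_inv, mul_inv]

/-- `1`-coboundaries. -/
def B1 (ρ : Γ →* MulAut A) : Subgroup (Γ → A) where
  carrier := {c | ∃ a, ∀ g, c g = ρ g a / a}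
  one_mem' := ⟨1, fun g => by simp⟩
  mul_mem' := by
    rintro c d ⟨a, ha⟩ ⟨b, hb⟩
    exact ⟨a * b, fun g => by simp only [Pi.mul_apply, ha, hb, map_mul, mul_div_mul_comm]⟩
  inv_mem' := by
    rintro c ⟨a, ha⟩
    exact ⟨a⁻¹, fun g => by simp [ha, div_eq_mul_inv, mul_comm]⟩

/-- The first continuous cohomology group `H¹(Γ, A)`, where `Γ` acts on `A` through `ρ`. -/
abbrev H1 (ρ : Γ →* MulAut A) : Type _ := Z1 ρ ⧸ (B1 ρ).subgroupOf (Z1 ρ)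

variable (Γ A) in
/-- Continuous `2`-cocycles with values in the constant `Γ`-module `A`. -/
def Z2 : Subgroup (Γ × Γ → A) where
  carrier := {c | Continuous c ∧
    ∀ g h j, c (h, j) * c (g, h * j) = c (g * h, j) * c (g, h)}
  one_mem' := ⟨continuous_const, fun g h j => by simp⟩
  mul_mem' := by
    rintro c d ⟨hc, hc'⟩ ⟨hd, hd'⟩
    refine ⟨hc.mul hd, fun g h j => ?_⟩
    simp only [Pi.mul_apply]
    rw [mul_mul_mul_comm, hc', hd', mul_mul_mul_comm]
  inv_mem' := by
    rintro c ⟨hc, hc'⟩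
    refine ⟨hc.inv, fun g h j => ?_⟩
    simp only [Pi.inv_apply, ← mul_inv, hc']

variable (Γ A) in
/-- `2`-coboundaries, with values in the constant `Γ`-module `A`. -/
def B2 : Subgroup (Γ × Γ → A) where
  carrier := {c | ∃ b : Γ → A, Continuous b ∧ ∀ g h, c (g, h) = b g * b h / b (g * h)}
  one_mem' := ⟨1, continuous_const, fun g h => by simp⟩
  mul_mem' := by
    rintro c d ⟨a, ha', ha⟩ ⟨b, hb', hb⟩
    refine ⟨a * b, ha'.mul hb', fun g h => ?_⟩
    simp only [Pi.mul_apply, ha, hb]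
    rw [div_mul_div_comm, mul_mul_mul_comm]
  inv_mem' := by
    rintro c ⟨a, ha', ha⟩
    refine ⟨a⁻¹, ha'.inv, fun g h => ?_⟩
    simp only [Pi.inv_apply, ha, ← mul_inv, inv_div, div_inv_eq_mul]
    rw [inv_mul_eq_div]

variable (Γ A) in
/-- The second continuous cohomology group `H²(Γ, A)` of the constant `Γ`-module `A`. -/
abbrev H2 : Type _ := Z2 Γ A ⧸ (B2 Γ A).subgroupOf (Z2 Γ A)

variable {Δ : Type*} [Group Δ] [TopologicalSpace Δ]

/-- Pullback of `2`-cocycles along a continuous homomorphism. -/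
def Z2.pullback (f : Δ →ₜ* Γ) : Z2 Γ A →* Z2 Δ A where
  toFun c := ⟨fun p => c.1 (f p.1, f p.2),
    c.2.1.comp ((f.continuous_toFun.comp continuous_fst).prodMk
      (f.continuous_toFun.comp continuous_snd)),
    fun g h j => by simpa only [map_mul] using c.2.2 (f g) (f h) (f j)⟩
  map_one' := rfl
  map_mul' _ _ := rfl

/-- The homomorphism `H²(Γ, A) → H²(Δ, A)` induced by a continuous homomorphism `Δ → Γ`
(restriction along an inclusion, inflation along a quotient map). -/
def H2.pullback (f : Δ →ₜ* Γ) : H2 Γ A →* H2 Δ A :=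
  QuotientGroup.map _ _ (Z2.pullback f) (by
    rintro c ⟨b, hb, hc⟩
    refine ⟨fun g => b (f g), hb.comp f.continuous_toFun, fun g h => ?_⟩
    have h1 := hc (f g) (f h)
    rw [← map_mul] at h1
    exact h1)

end Cohomology

/-! ### The obstruction to lifting a homomorphism along `G → G / Z(G)` -/

section Obstruction

instance instCommGroupCenter (G : Type*) [Group G] : CommGroup (Subgroup.center G) where
  mul_comm a b := Subtype.ext (Subgroup.mem_center_iff.1 b.2 a)

variable {Γ G : Type*} [Group Γ] [TopologicalSpace Γ] [ContinuousMul Γ] [Group G]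
  [TopologicalSpace G] [DiscreteTopology G]

/-- The `2`-cocycle `(g, h) ↦ u(g) u(h) u(gh)⁻¹` attached to a continuous set-theoretic lift `u`
of `φ : Γ → G / Z(G)`. -/
def liftCocycle (φ : Γ →ₜ* G ⧸ Subgroup.center G) (u : Γ → G) (hu : Continuous u)
    (hφ : ∀ g, (u g : G ⧸ Subgroup.center G) = φ g) : Z2 Γ (Subgroup.center G) :=
  have hmem : ∀ g h, u g * u h * (u (g * h))⁻¹ ∈ Subgroup.center G := fun g h => by
    rw [← QuotientGroup.eq_one_iff]
    simp [hφ]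
  ⟨fun p => ⟨u p.1 * u p.2 * (u (p.1 * p.2))⁻¹, hmem _ _⟩, by
    refine ⟨Continuous.subtype_mk (((hu.comp continuous_fst).mul (hu.comp continuous_snd)).mul
      (hu.comp (continuous_fst.mul continuous_snd)).inv) _, fun g h j => Subtype.ext ?_⟩
    have h1 := Subgroup.mem_center_iff.1 (hmem h j) (u g)
    change u h * u j * (u (h * j))⁻¹ * (u g * u (h * j) * (u (g * (h * j)))⁻¹) =
      u (g * h) * u j * (u (g * h * j))⁻¹ * (u g * u h * (u (g * h))⁻¹)
    have h2 := Subgroup.mem_center_iff.1 (hmem g h) (u (g * h) * u j * (u (g * h * j))⁻¹)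
    rw [h2, ← mul_assoc, ← mul_assoc, ← h1, mul_assoc g h j]
    group⟩

/-- The class in `H²(Γ, Z(G))` that obstructs the existence of a continuous homomorphism
`Γ → G` lifting `φ`. -/
def obstruction (φ : Γ →ₜ* G ⧸ Subgroup.center G) : H2 Γ (Subgroup.center G) :=
  have : DiscreteTopology (G ⧸ Subgroup.center G) :=
    QuotientGroup.discreteTopology (isOpen_discrete _)
  QuotientGroup.mk (liftCocycle φ (fun g => (φ g).out)
    (continuous_of_discreteTopology.comp φ.continuous_toFun) fun _ => Quotient.out_eq' _)

/-- The obstruction class can be computed from any continuous lift. -/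
theorem obstruction_eq (φ : Γ →ₜ* G ⧸ Subgroup.center G) (u : Γ → G) (hu : Continuous u)
    (hφ : ∀ g, (u g : G ⧸ Subgroup.center G) = φ g) :
    obstruction φ = QuotientGroup.mk (liftCocycle φ u hu hφ) := by
  have : DiscreteTopology (G ⧸ Subgroup.center G) :=
    QuotientGroup.discreteTopology (isOpen_discrete _)
  have hw : Continuous fun g => (φ g).out :=
    continuous_of_discreteTopology.comp φ.continuous_toFun
  have hb : ∀ g, ((φ g).out)⁻¹ * u g ∈ Subgroup.center G := fun g => by
    rw [← QuotientGroup.eq, hφ]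
    exact Quotient.out_eq' _
  refine QuotientGroup.eq.2 ⟨fun g => ⟨((φ g).out)⁻¹ * u g, hb g⟩,
    Continuous.subtype_mk (hw.inv.mul hu) _, fun g h => Subtype.ext ?_⟩
  set w : Γ → G := fun g => (φ g).out with hwdef
  have key : ∀ g, ∃ z ∈ Subgroup.center G, u g = w g * z := fun g => ⟨_, hb g, by simp [hwdef]⟩
  obtain ⟨x, hx, hx'⟩ := key g
  obtain ⟨y, hy, hy'⟩ := key h
  obtain ⟨z, hz, hz'⟩ := key (g * h)
  rw [div_eq_mul_inv]
  change (w g * w h * (w (g * h))⁻¹)⁻¹ * (u g * u h * (u (g * h))⁻¹) =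
    ((w g)⁻¹ * u g) * ((w h)⁻¹ * u h) * ((w (g * h))⁻¹ * u (g * h))⁻¹
  rw [hx', hy', hz']
  have cx := Subgroup.mem_center_iff.1 hx
  have cy := Subgroup.mem_center_iff.1 hy
  have cz := Subgroup.mem_center_iff.1 (inv_mem hz)
  simp only [mul_inv_rev, inv_inv, inv_mul_cancel_left]
  calc _ = w (g * h) * (w h)⁻¹ * (w g)⁻¹ * (w g * (x * w h)) * y * (z⁻¹ * (w (g * h))⁻¹) := by
        simp only [mul_assoc]
    _ = w (g * h) * (x * (y * z⁻¹)) * (w (g * h))⁻¹ := by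
        rw [← cx (w h)]; group
    _ = _ := by
        have : x * (y * z⁻¹) ∈ Subgroup.center G := mul_mem hx (mul_mem hy (inv_mem hz))
        rw [Subgroup.mem_center_iff.1 this]; group

/-- The action of `G / Z(G)` on `G` by conjugation. -/
def conjAction (G : Type*) [Group G] : G ⧸ Subgroup.center G →* MulAut G :=
  QuotientGroup.lift (Subgroup.center G) MulAut.conj fun z hz => MulEquiv.ext fun g => by
    rw [MulAut.conj_apply, ← Subgroup.mem_center_iff.1 hz g, mul_inv_cancel_right]
    rfl

end Obstruction

/-! ### The residue of a `2`-cocycle on a split extension -/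

section Residue

variable {Γ Q A : Type*} [Group Γ] [TopologicalSpace Γ] [IsTopologicalGroup Γ]
  [Group Q] [TopologicalSpace Q] [CommGroup A] [TopologicalSpace A] [IsTopologicalGroup A]

/-- For a normal subgroup `N` of `Γ`, the action of `Γ` on the group `Hom(N, A)` of continuous
homomorphisms, given by `(g • η)(n) = η(g⁻¹ n g)`. -/
def homAction (N : Subgroup Γ) [N.Normal] (A : Type*) [CommGroup A] [TopologicalSpace A]
    [IsTopologicalGroup A] : Γ →* MulAut (N →ₜ* A) :=
  have hc : ∀ g : Γ, Continuous fun n : N => MulAut.conjNormal g n := fun g => by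
    refine Continuous.subtype_mk (f := fun n : N => g * n * g⁻¹) ?_ _
    exact (continuous_const.mul continuous_subtype_val).mul continuous_const
  let T : Γ → (N →ₜ* A) → (N →ₜ* A) := fun g η =>
    ⟨η.toMonoidHom.comp (MulAut.conjNormal g⁻¹ : MulAut N).toMonoidHom,
      η.continuous_toFun.comp (hc g⁻¹)⟩
  have hT : ∀ g h η, T g (T h η) = T (g * h) η := fun g h η => by
    ext n
    change η (MulAut.conjNormal h⁻¹ (MulAut.conjNormal g⁻¹ n)) = η (MulAut.conjNormal (g * h)⁻¹ n)
    rw [mul_inv_rev, map_mul]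
    rfl
  have h1 : ∀ η, T 1 η = η := fun η => by
    ext n
    change η (MulAut.conjNormal 1⁻¹ n) = η n
    rw [inv_one, map_one]
    rfl
  { toFun := fun g =>
      { toFun := T g
        invFun := T g⁻¹
        left_inv := fun η => by rw [hT, inv_mul_cancel, h1]
        right_inv := fun η => by rw [hT, mul_inv_cancel, h1]
        map_mul' := fun _ _ => rfl }
    map_one' := MulEquiv.ext h1
    map_mul' := fun g h => MulEquiv.ext fun η => (hT g h η).symm }

theorem homAction_apply (N : Subgroup Γ) [N.Normal] (g : Γ) (η : N →ₜ* A) (n : N) :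
    homAction N A g η n = η (MulAut.conjNormal g⁻¹ n) := rfl

/-- A `2`-cocycle on `Γ` is adapted to `π : Γ → Q` if it is normalized and if it depends on its
second argument only through the image of this argument in `Q`. -/
structure IsAdapted (π : Γ →ₜ* Q) (a : Γ × Γ → A) : Prop where
  one_left : ∀ g, a (1, g) = 1
  one_right : ∀ g, a (g, 1) = 1
  factors : ∀ g h h', π h = π h' → a (g, h) = a (g, h')

/-- The residue of an adapted `2`-cocycle `a`: the `1`-cocycle on `Q` with values in
`Hom(ker π, A)` that sends `γ` to `n ↦ a(n, γ)`. Here `γ` in the second argument stands for any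
lift of `γ` to `Γ`, and the lift `s γ` is used. -/
def residueCocycle (π : Γ →ₜ* Q) (s : Q →ₜ* Γ) (a : Z2 Γ A) (ha : IsAdapted π a.1) :
    Z1 ((homAction π.toMonoidHom.ker A).comp s.toMonoidHom) :=
  ⟨fun γ =>
    { toFun := fun n => a.1 (n, s γ)
      map_one' := ha.one_left _
      map_mul' := fun n m => by
        have h := a.2.2 n m (s γ)
        have hm : π (m : Γ) = 1 := m.2
        rw [ha.factors n m 1 (by rw [hm, map_one]), ha.one_right, mul_one,
          ha.factors n (m * s γ) (s γ) (by rw [map_mul, hm, one_mul])] at h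
        rw [Subgroup.coe_mul, ← h, mul_comm]
      continuous_toFun := a.2.1.comp (continuous_subtype_val.prodMk continuous_const) },
    ContinuousMonoidHom.continuous_of_continuous_uncurry _
      (a.2.1.comp ((continuous_subtype_val.comp continuous_snd).prodMk
        (s.continuous_toFun.comp continuous_fst))), fun γ δ => by
    ext n
    change a.1 (n, s (γ * δ)) = a.1 (n, s γ) * a.1 (_, s δ)
    set m : π.toMonoidHom.ker := MulAut.conjNormal (s γ)⁻¹ n with hm
    have hm' : s γ * (m : Γ) = n * s γ := by
      rw [hm, MulAut.conjNormal_apply]; group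
    have hm1 : π (m : Γ) = 1 := m.2
    have h1 := a.2.2 n (s γ) (s δ)
    have h2 := a.2.2 (s γ) m (s δ)
    rw [hm', ha.factors (s γ) (m * s δ) (s δ) (by rw [map_mul, hm1, one_mul]),
      ha.factors (s γ) m 1 (by rw [hm1, map_one]), ha.one_right, mul_one] at h2
    rw [map_mul, ← mul_left_cancel_iff (a := a.1 (s γ, s δ)), h1, ← h2]
    change _ = _ * (_ * a.1 (m, s δ))
    rw [mul_comm (a.1 (m, s δ)), mul_assoc, mul_comm (a.1 (n, s γ))]⟩

end Residue

/-! ### Tame Galois groups of henselian discretely valued fields -/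

section LocalRing

open Polynomial in
theorem isLocalRing_of_isInvariant (A B H : Type*) [CommRing A] [HenselianLocalRing A]
    [CommRing B] [IsDomain B] [Algebra A B] [Algebra.IsIntegral A B] [FaithfulSMul A B]
    [Group H] [Finite H] [MulSemiringAction H B] [SMulCommClass H A B]
    [Algebra.IsInvariant A B H] : IsLocalRing B := by
  classical
  have hfix : ∀ (τ : H) (a : A), τ • algebraMap A B a = algebraMap A B a := fun τ a => by
    rw [Algebra.algebraMap_eq_smul_one, smul_comm, smul_one]
  refine IsLocalRing.of_unique_max_ideal ?_
  obtain ⟨n₁, hn₁⟩ := Ideal.exists_maximal B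
  refine ⟨n₁, hn₁, fun n₂ hn₂ => ?_⟩
  by_contra hne
  have hu : ∀ n : Ideal B, n.IsMaximal → n.under A = IsLocalRing.maximalIdeal A := fun n hn =>
    IsLocalRing.eq_maximalIdeal (Ideal.isMaximal_comap_of_isIntegral_of_isMaximal n)
  obtain ⟨σ, hσ⟩ := Algebra.IsInvariant.exists_smul_of_under_eq A B H n₁ n₂
    ((hu _ hn₁).trans (hu _ hn₂).symm)
  have hmax : ∀ τ : H, (τ • n₁).IsMaximal := fun τ =>
    Ideal.map_isMaximal_of_equiv (MulSemiringAction.toRingEquiv H B τ)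
  have hex : ∀ τ : H, ∃ u : B, (τ • n₁ ≠ n₁ → u ∈ τ • n₁) ∧ 1 - u ∈ n₁ := by
    intro τ
    by_cases h : τ • n₁ = n₁
    · exact ⟨1, fun h' => (h' h).elim, by simp⟩
    · have hsup := Ideal.IsMaximal.coprime_of_ne (hmax τ) hn₁ h
      obtain ⟨u, hu, w, hw, huw⟩ := Submodule.mem_sup.1
        (show (1 : B) ∈ τ • n₁ ⊔ n₁ from hsup ▸ Submodule.mem_top)
      exact ⟨u, fun _ => hu, by rw [← huw]; simpa using hw⟩
  choose u hu1 hu2 using hex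
  have := Fintype.ofFinite H
  set q := Ideal.Quotient.mk n₁ with hq
  have hmem : ∀ x : B, x ∈ n₁ ↔ q x = 0 := fun x => Ideal.Quotient.eq_zero_iff_mem.symm
  have hqu : ∀ τ, q (u τ) = 1 := fun τ => by
    have := (hmem _).1 (hu2 τ)
    rw [map_sub, map_one, sub_eq_zero] at this
    exact this.symm
  set z : B := ∏ τ : H, u τ with hz
  have hqz : q z = 1 := by rw [hz, map_prod]; exact Finset.prod_eq_one fun τ _ => hqu τ
  let D := MulAction.stabilizer H n₁
  set β : B := ∏ d : D, (d : H) • z with hβ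
  have hqβ : q β = 1 := by
    rw [hβ, map_prod]
    refine Finset.prod_eq_one fun d _ => ?_
    have hd : ((d : H)) • n₁ = n₁ := d.2
    have h1 : (1 - z) ∈ n₁ := by rw [hmem, map_sub, hqz, map_one, sub_self]
    have h2 : (d : H) • (1 - z) ∈ n₁ := hd ▸ Ideal.smul_mem_pointwise_smul _ _ _ h1
    rw [smul_sub, smul_one, hmem, map_sub, map_one, sub_eq_zero] at h2
    exact h2.symm
  have hβmem : ∀ τ : H, τ • n₁ ≠ n₁ → β ∈ τ • n₁ := by
    intro τ hτ
    have h1 : z ∈ τ • n₁ := Ideal.mem_of_dvd _ (Finset.dvd_prod_of_mem _ (Finset.mem_univ τ))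
      (hu1 τ hτ)
    refine Ideal.mem_of_dvd _ (Finset.dvd_prod_of_mem _ (Finset.mem_univ (1 : D))) ?_
    simpa using h1
  have hβD : ∀ τ : H, τ • n₁ = n₁ → τ • β = β := by
    intro τ hτ
    rw [hβ, Finset.smul_prod']
    refine Fintype.prod_equiv (Equiv.mulLeft (⟨τ, hτ⟩ : D)) _ _ fun d => ?_
    simp [mul_smul]
  have hβ0 : ∀ τ : H, τ • n₁ ≠ n₁ → q (τ • β) = 0 := by
    intro τ hτ
    rw [← hmem]
    have h1 : τ⁻¹ • n₁ ≠ n₁ := fun h => hτ (by rw [← h, smul_inv_smul, h])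
    have := Ideal.smul_mem_pointwise_smul τ _ _ (hβmem _ h1)
    rwa [smul_inv_smul] at this
  let S : Finset B := Finset.univ.image fun τ : H => τ • β
  have hβS : β ∈ S := Finset.mem_image.2 ⟨1, Finset.mem_univ _, one_smul _ _⟩
  let g : B[X] := ∏ b ∈ S, (X - C b)
  have hgm : g.Monic := monic_prod_of_monic _ _ fun b _ => monic_X_sub_C b
  have hgl : g ∈ lifts (algebraMap A B) := by
    rw [lifts_iff_coeff_lifts]
    intro n
    refine Algebra.IsInvariant.isInvariant (G := H) _ fun τ => ?_
    have h1 : τ • g = g := by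
      simp only [g]
      rw [Finset.smul_prod']
      refine Finset.prod_bij (fun b _ => τ • b) ?_ ?_ ?_ ?_
      · intro b hb
        obtain ⟨ρ, -, rfl⟩ := Finset.mem_image.1 hb
        exact Finset.mem_image.2 ⟨τ * ρ, Finset.mem_univ _, mul_smul _ _ _⟩
      · intro a _ b _ h
        exact smul_left_cancel τ h
      · intro b hb
        obtain ⟨ρ, -, rfl⟩ := Finset.mem_image.1 hb
        exact ⟨(τ⁻¹ * ρ) • β, Finset.mem_image.2 ⟨_, Finset.mem_univ _, rfl⟩, by
          rw [← mul_smul]; simp⟩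
      · intro b _
        rw [smul_sub, smul_X, smul_C]
    rw [← coeff_smul, h1]
  obtain ⟨f, hf, -, hfm⟩ := lifts_and_natDegree_eq_and_monic hgl hgm
  have hgev : ∀ x : B, g.eval x = ∏ b ∈ S, (x - b) := fun x => by
    simp [g, eval_prod]
  have hgd : q (g.derivative.eval β) = 1 := by
    have h1 : g = (X - C β) * ∏ b ∈ S.erase β, (X - C b) :=
      (Finset.mul_prod_erase S (fun b => X - C b) hβS).symm
    rw [h1, derivative_mul]
    simp only [derivative_sub, derivative_X, derivative_C, sub_zero, one_mul, eval_add, eval_mul,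
      eval_sub, eval_X, eval_C, sub_self, zero_mul, add_zero, eval_prod, map_prod]
    refine Finset.prod_eq_one fun b hb => ?_
    obtain ⟨hb1, hb2⟩ := Finset.mem_erase.1 hb
    obtain ⟨τ, -, rfl⟩ := Finset.mem_image.1 hb2
    rw [map_sub, hqβ, hβ0 τ (fun h => hb1 (hβD τ h)), sub_zero]
  have hqev : ∀ (p : B[X]) (x y : B), q x = q y → q (p.eval x) = q (p.eval y) := by
    intro p x y h
    rw [← eval₂_at_apply, ← eval₂_at_apply, h]
  have hA : ∀ a : A, q (algebraMap A B a) = 0 ↔ a ∈ IsLocalRing.maximalIdeal A := by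
    intro a
    rw [← hmem, ← hu _ hn₁]; rfl
  have hev : ∀ (p : A[X]) (a : A), algebraMap A B (p.eval a)
      = (p.map (algebraMap A B)).eval (algebraMap A B a) := fun p a => by
    rw [eval_map, eval₂_at_apply]
  have h1 : f.eval 1 ∈ IsLocalRing.maximalIdeal A := by
    rw [← hA, hev, hf, map_one, hqev g 1 β (by rw [hqβ, map_one]), hgev,
      Finset.prod_eq_zero hβS (sub_self β), map_zero]
  have h2 : IsUnit (f.derivative.eval 1) := by
    by_contra h
    have h3 := (hA _).2 ((IsLocalRing.mem_maximalIdeal _).2 h)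
    rw [hev, ← derivative_map, hf, map_one,
      hqev _ 1 β (by rw [hqβ, map_one]), hgd] at h3
    exact one_ne_zero h3
  obtain ⟨a, ha, -⟩ := HenselianLocalRing.is_henselian f hfm 1 h1 h2
  have h3 : g.eval (algebraMap A B a) = 0 := by rw [← hf, ← hev, ha.eq_zero, map_zero]
  rw [hgev, Finset.prod_eq_zero_iff] at h3
  obtain ⟨b, hb, hab⟩ := h3
  obtain ⟨τ, -, rfl⟩ := Finset.mem_image.1 hb
  have h4 : β = algebraMap A B a := by
    rw [← hfix τ a] at hab
    exact (smul_left_cancel τ (sub_eq_zero.1 hab)).symm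
  have h5 := hβ0 σ (fun h => hne (hσ.trans h))
  rw [h4, hfix, ← h4, hqβ] at h5
  exact one_ne_zero h5

theorem isLocalRing_integralClosure (A K L : Type*) [CommRing A] [IsDomain A]
    [HenselianLocalRing A] [IsIntegrallyClosed A]
    [Field K] [Algebra A K] [IsFractionRing A K] [Field L] [Algebra K L] [Algebra A L]
    [IsScalarTower A K L] [IsGalois K L] : IsLocalRing (integralClosure A L) := by
  have key : ∀ E : FiniteGaloisIntermediateField K L, IsLocalRing (integralClosure A E) := by
    intro E
    have := integralClosure.isFractionRing_of_finite_extension (A := A) K E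
    let := IsIntegralClosure.MulSemiringAction A K E (integralClosure A E)
    have : SMulCommClass Gal(E/K) A (integralClosure A E) :=
      ⟨fun σ a b => ((galRestrict A K E (integralClosure A E)) σ).toLinearEquiv.map_smul a b⟩
    have := Algebra.isInvariant_of_isGalois A K E (integralClosure A E)
    have : FaithfulSMul A E := FaithfulSMul.trans A K E
    exact isLocalRing_of_isInvariant A (integralClosure A E) Gal(E/K)
  have hunit : ∀ (E : FiniteGaloisIntermediateField K L) (x : integralClosure A E)
      (y : integralClosure A L), ((x : E) : L) = y → (IsUnit x ↔ IsUnit y) := by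
    intro E x y h
    let φ : E →ₐ[A] L := (E.val).restrictScalars A
    constructor
    · intro hx
      have h1 : φ.mapIntegralClosure x = y := Subtype.ext h
      rw [← h1]; exact hx.map _
    · rintro ⟨y, rfl⟩
      have hy : ((y : integralClosure A L) : L) * ((y⁻¹ : (integralClosure A L)ˣ) : integralClosure A L) = 1 := by
        rw [← Subalgebra.coe_mul, y.mul_inv]; rfl
      have hy' : ((x : E) : L)⁻¹ = ((y⁻¹ : (integralClosure A L)ˣ) : integralClosure A L) := by
        rw [h]; exact (eq_inv_of_mul_eq_one_right hy).symm
      have hi : IsIntegral A ((x : E)⁻¹) := by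
        rw [← isIntegral_algHom_iff φ (RingHom.injective φ.toRingHom)]
        have : φ ((x : E)⁻¹) = ((x : E) : L)⁻¹ := map_inv₀ (E.val) _
        rw [this, hy']; exact ((y⁻¹ : (integralClosure A L)ˣ) : integralClosure A L).2
      refine IsUnit.of_mul_eq_one ⟨_, hi⟩ (Subtype.ext ?_)
      refine mul_inv_cancel₀ fun h0 => ?_
      rw [← h, h0] at hy
      simp at hy
  refine IsLocalRing.of_is_unit_or_is_unit_of_add_one fun {a b} hab => ?_
  let E := FiniteGaloisIntermediateField.adjoin K ({(a : L)} : Set L)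
  have ha : (a : L) ∈ E.toIntermediateField := FiniteGaloisIntermediateField.subset_adjoin K _ rfl
  have := key E
  have hb : (b : L) ∈ E.toIntermediateField := by
    have : (b : L) = 1 - a := by
      rw [eq_sub_iff_add_eq', ← Subalgebra.coe_add, hab]; rfl
    rw [this]; exact sub_mem (one_mem _) ha
  let φ : E →ₐ[A] L := (E.val).restrictScalars A
  let a' : integralClosure A E := ⟨⟨a, ha⟩, (isIntegral_algHom_iff φ (RingHom.injective φ.toRingHom)).1 a.2⟩
  let b' : integralClosure A E := ⟨⟨b, hb⟩, (isIntegral_algHom_iff φ (RingHom.injective φ.toRingHom)).1 b.2⟩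
  rw [← hunit E a' a rfl, ← hunit E b' b rfl]
  refine IsLocalRing.isUnit_or_isUnit_of_add_one (Subtype.ext (Subtype.ext ?_))
  exact congrArg (fun x : integralClosure A L => (x : L)) hab

end LocalRing

theorem exists_finset_adjoin_eq {F K : Type*} [Field F] [Field K] [Algebra F K]
    (E : IntermediateField F K) (hE : FiniteDimensional F E) :
    ∃ S : Finset K, IntermediateField.adjoin F (S : Set K) = E :=
  IntermediateField.fg_of_fg_toSubalgebra E
    (Subalgebra.fg_of_fg_toSubmodule ((Submodule.fg_top _).1 (Module.finite_def.1 hE)))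

section Field

variable {k : Type*} [Field k] (𝒪 : ValuationSubring k) [HenselianLocalRing 𝒪]
  (ks : Type*) [Field ks] [Algebra k ks] [IsGalois k ks]

instance instIsLocalRingIntegralClosure : IsLocalRing (integralClosure 𝒪 ks) :=
  isLocalRing_integralClosure 𝒪 k ks

instance instFaithfulSMulIntegralClosure : FaithfulSMul 𝒪 (integralClosure 𝒪 ks) := by
  have : FaithfulSMul 𝒪 ks := FaithfulSMul.trans 𝒪 k ks
  rw [faithfulSMul_iff_algebraMap_injective] at this ⊢
  exact fun x y h => this (congrArg (fun z : integralClosure 𝒪 ks => (z : ks)) h)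

/-- The residue field `k₀` of the valuation. -/
abbrev BaseResidueField : Type _ := ResidueField 𝒪

/-- The residue field of the integral closure of the valuation ring in the separable closure `ks`
of `k`. If `ks` is a separable closure of `k`, where `k` has characteristic `0` and `k₀`
is perfect, then this is a separable closure of `k₀`, as shown below. -/
abbrev SepResidueField : Type _ := ResidueField (integralClosure 𝒪 ks)

instance instIsLocalHomIntegralClosure :
    IsLocalHom (algebraMap 𝒪 (integralClosure 𝒪 ks)) :=
  Algebra.IsIntegral.isLocalHom _ _

instance instAlgebraSepResidueField :
    Algebra (BaseResidueField 𝒪) (SepResidueField 𝒪 ks) := inferInstance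

instance instSMulCommClassResidueField :
    SMulCommClass Gal(ks/k) (BaseResidueField 𝒪) (SepResidueField 𝒪 ks) where
  smul_comm σ c x := by
    obtain ⟨c, rfl⟩ := residue_surjective c
    obtain ⟨x, rfl⟩ := residue_surjective x
    rw [Algebra.smul_def, Algebra.smul_def, smul_mul', ResidueField.algebraMap_residue,
      ← ResidueField.residue_smul]
    congr 2
    exact Subtype.ext (σ.commutes (c : k))

instance instIsSepClosureResidueField [CharZero k] [IsSepClosure k ks]
    [PerfectField (BaseResidueField 𝒪)] :
    IsSepClosure (BaseResidueField 𝒪) (SepResidueField 𝒪 ks) := by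
  have : Algebra.IsAlgebraic (BaseResidueField 𝒪) (SepResidueField 𝒪 ks) := by
    refine ⟨fun x => ?_⟩
    obtain ⟨x, rfl⟩ := residue_surjective x
    obtain ⟨p, hp, hpx⟩ := Algebra.IsIntegral.isIntegral (R := 𝒪) x
    refine ⟨p.map (residue 𝒪), (hp.map _).ne_zero, ?_⟩
    have h1 := congrArg (residue (integralClosure 𝒪 ks)) hpx
    rw [map_zero, Polynomial.hom_eval₂] at h1
    rw [Polynomial.aeval_def, Polynomial.eval₂_map]
    exact h1
  have : IsAlgClosed ks := by
    have := IsSepClosure.sep_closed k (K := ks)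
    have : CharZero ks := charZero_of_injective_algebraMap (algebraMap k ks).injective
    infer_instance
  refine ⟨?_, inferInstance⟩
  have : IsAlgClosed (SepResidueField 𝒪 ks) := by
    refine IsAlgClosed.of_exists_root _ fun p hp hp' => ?_
    obtain ⟨q, hq, hdeg, hqm⟩ := Polynomial.lifts_and_natDegree_eq_and_monic
      ((Polynomial.mem_lifts _).2
        (Polynomial.map_surjective _ (residue_surjective (R := integralClosure 𝒪 ks)) p)) hp
    obtain ⟨z, hz⟩ := IsAlgClosed.exists_root
      (q.map (algebraMap (integralClosure 𝒪 ks) ks)) (by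
        rw [Polynomial.degree_map_eq_of_injective Subtype.val_injective,
          Polynomial.degree_eq_natDegree hqm.ne_zero, hdeg,
          ← Polynomial.degree_eq_natDegree hp.ne_zero]
        exact (Polynomial.degree_pos_of_irreducible hp').ne')
    rw [Polynomial.IsRoot.def, Polynomial.eval_map] at hz
    have hzi : IsIntegral 𝒪 z := isIntegral_trans (A := integralClosure 𝒪 ks) z ⟨q, hqm, hz⟩
    refine ⟨residue _ ⟨z, hzi⟩, ?_⟩
    rw [← hq, Polynomial.eval_map, Polynomial.eval₂_at_apply]
    have h2 : q.eval (⟨z, hzi⟩ : integralClosure 𝒪 ks) = 0 := by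
      refine Subtype.ext ?_
      change algebraMap (integralClosure 𝒪 ks) ks _ = 0
      rw [← Polynomial.eval₂_at_apply]
      exact hz
    rw [h2, map_zero]
  infer_instance

/-- The absolute Galois group `Γ_k₀` of the residue field. -/
abbrev ResidueGal : Type _ := Gal(SepResidueField 𝒪 ks/BaseResidueField 𝒪)

/-- The natural map `Γ_k → Γ_k₀`. -/
def toResidueGal : Gal(ks/k) →ₜ* ResidueGal 𝒪 ks where
  toMonoidHom :=
    MulSemiringAction.toAlgAut Gal(ks/k) (BaseResidueField 𝒪) (SepResidueField 𝒪 ks)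
  continuous_toFun := by
    refine continuous_of_continuousAt_one (MulSemiringAction.toAlgAut Gal(ks/k)
      (BaseResidueField 𝒪) (SepResidueField 𝒪 ks)) ?_
    intro U hU
    rw [map_one] at hU
    obtain ⟨E, hE, hEU⟩ := (krullTopology_mem_nhds_one_iff _ _ _).1 hU
    obtain ⟨S, hS⟩ := exists_finset_adjoin_eq E hE
    choose r hr using residue_surjective (R := integralClosure 𝒪 ks)
    let F := IntermediateField.adjoin k ((fun x => (r x : ks)) '' (S : Set (SepResidueField 𝒪 ks)))
    have hF : FiniteDimensional k F :=
      IntermediateField.finiteDimensional_adjoin fun x _ => Algebra.IsIntegral.isIntegral x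
    refine Filter.mem_map.2 <| Filter.mem_of_superset (F.fixingSubgroup_isOpen.mem_nhds (one_mem _)) fun σ hσ => ?_
    refine hEU ?_
    set g := MulSemiringAction.toAlgAut Gal(ks/k)
      (BaseResidueField 𝒪) (SepResidueField 𝒪 ks) σ with hg
    suffices h : E ≤ IntermediateField.fixedField (Subgroup.zpowers g) from
      (IntermediateField.le_iff_le _ _).1 h (Subgroup.mem_zpowers g)
    rw [← hS, IntermediateField.adjoin_le_iff]
    intro x hx
    have h1 : g x = x := by
      have h2 : σ • r x = r x := Subtype.ext
        (hσ ⟨_, IntermediateField.subset_adjoin k _ ⟨x, hx, rfl⟩⟩)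
      conv_lhs => rw [← hr x]
      conv_rhs => rw [← hr x, ← h2]
      rfl
    rintro ⟨τ, hτ⟩
    have h3 : Subgroup.zpowers g ≤ MulAction.stabilizer _ x := by
      rw [Subgroup.zpowers_le]
      exact h1
    exact h3 hτ

theorem toResidueGal_residue (σ : Gal(ks/k)) (x : integralClosure 𝒪 ks) :
    toResidueGal 𝒪 ks σ (residue _ x) = residue _ (σ • x) := rfl

theorem smul_mem_maximalIdeal (σ : Gal(ks/k)) {x : integralClosure 𝒪 ks}
    (hx : x ∈ maximalIdeal (integralClosure 𝒪 ks)) :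
    σ • x ∈ maximalIdeal (integralClosure 𝒪 ks) := by
  rw [← residue_eq_zero_iff] at hx ⊢
  rw [ResidueField.residue_smul, hx, smul_zero]

/-- The wild inertia group: the `σ` with `σ(x)/x ≡ 1` modulo the maximal ideal for all `x ≠ 0`. -/
def wildInertia : Subgroup Gal(ks/k) where
  carrier := {σ | ∀ x : ks, ∃ y ∈ maximalIdeal (integralClosure 𝒪 ks), σ x = x * (1 + y)}
  one_mem' := fun x => ⟨0, zero_mem _, by simp⟩
  mul_mem' := by
    intro σ τ hσ hτ x
    obtain ⟨y, hy, hy'⟩ := hτ x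
    obtain ⟨z, hz, hz'⟩ := hσ x
    refine ⟨z + σ • y + z * σ • y, add_mem (add_mem hz (smul_mem_maximalIdeal 𝒪 ks σ hy))
      (Ideal.mul_mem_right _ _ hz), ?_⟩
    rw [AlgEquiv.mul_apply, hy', map_mul, hz', map_add, map_one]
    push_cast
    rw [integralClosure.coe_smul, AlgEquiv.smul_def]
    ring
  inv_mem' := by
    intro σ hσ x
    obtain ⟨y, hy, hy'⟩ := hσ (σ⁻¹ x)
    have hu : IsUnit (1 + y) := by
      by_contra h
      have h1 := (mem_maximalIdeal _).2 h
      exact (Ideal.ne_top_iff_one _).1 (maximalIdeal.isMaximal _).ne_top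
        ((Submodule.add_mem_iff_left _ hy).1 h1)
    obtain ⟨w, hw⟩ := hu
    refine ⟨((w⁻¹ : (integralClosure 𝒪 ks)ˣ) : integralClosure 𝒪 ks) * (1 - w), ?_, ?_⟩
    · refine Ideal.mul_mem_left _ _ ?_
      rw [hw]
      simpa using hy
    · have h1 : x = σ⁻¹ x * ((w : integralClosure 𝒪 ks) : ks) := by
        have h2 : σ (σ⁻¹ x) = x := by
          rw [← AlgEquiv.mul_apply, mul_inv_cancel]; rfl
        rw [h2] at hy'
        rw [hw]
        exact_mod_cast hy'
      have h3 : ((w : integralClosure 𝒪 ks) : ks) *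
          (((w⁻¹ : (integralClosure 𝒪 ks)ˣ) : integralClosure 𝒪 ks) : ks) = 1 := by
        rw [← Subalgebra.coe_mul, w.mul_inv]; rfl
      push_cast
      have h4 : σ⁻¹ x = x * (((w⁻¹ : (integralClosure 𝒪 ks)ˣ) : integralClosure 𝒪 ks) : ks) := by
        conv_rhs => rw [h1, mul_assoc, h3, mul_one]
      rw [h4]
      linear_combination x * h3

instance instNormalWildInertia : (wildInertia 𝒪 ks).Normal where
  conj_mem σ hσ τ x := by
    obtain ⟨y, hy, hy'⟩ := hσ (τ⁻¹ x)
    refine ⟨τ • y, smul_mem_maximalIdeal 𝒪 ks τ hy, ?_⟩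
    have h2 : τ (τ⁻¹ x) = x := by
      rw [← AlgEquiv.mul_apply, mul_inv_cancel]; rfl
    rw [AlgEquiv.mul_apply, AlgEquiv.mul_apply, hy', map_mul, h2, map_add, map_one]
    rfl

/-- The maximal tame quotient `Γ_k^t` of `Γ_k`. -/
abbrev TameGal : Type _ := Gal(ks/k) ⧸ wildInertia 𝒪 ks

/-- The quotient map `Γ_k → Γ_k^t`. -/
def toTameGal : Gal(ks/k) →ₜ* TameGal 𝒪 ks where
  toMonoidHom := QuotientGroup.mk' (wildInertia 𝒪 ks)
  continuous_toFun := QuotientGroup.continuous_mk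

/-- A continuous homomorphism on `Γ_k` that is trivial on wild inertia, as a continuous
homomorphism on `Γ_k^t`. -/
def tameLift {H : Type*} [Group H] [TopologicalSpace H] (φ : Gal(ks/k) →ₜ* H)
    (hφ : ∀ σ ∈ wildInertia 𝒪 ks, φ σ = 1) : TameGal 𝒪 ks →ₜ* H where
  toMonoidHom := QuotientGroup.lift (wildInertia 𝒪 ks) φ.toMonoidHom hφ
  continuous_toFun := φ.continuous_toFun.quotient_lift _

theorem toResidueGal_of_mem_wildInertia :
    ∀ σ ∈ wildInertia 𝒪 ks, toResidueGal 𝒪 ks σ = 1 := by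
  intro σ hσ
  refine AlgEquiv.ext fun x => ?_
  obtain ⟨x, rfl⟩ := residue_surjective x
  obtain ⟨y, hy, hy'⟩ := hσ x
  have h1 : σ • x = x + x * y := Subtype.ext (by
    rw [integralClosure.coe_smul, AlgEquiv.smul_def, hy']
    push_cast
    ring)
  rw [toResidueGal_residue, h1, map_add, (residue_eq_zero_iff _).2 (Ideal.mul_mem_left _ x hy),
    add_zero]
  rfl

/-- The natural map `Γ_k^t → Γ_k₀`. -/
def tameToResidueGal : TameGal 𝒪 ks →ₜ* ResidueGal 𝒪 ks :=
  tameLift 𝒪 ks (toResidueGal 𝒪 ks) (toResidueGal_of_mem_wildInertia 𝒪 ks)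

/-- The tame inertia group `I^t`. -/
abbrev TameInertia : Subgroup (TameGal 𝒪 ks) := (tameToResidueGal 𝒪 ks).toMonoidHom.ker

section Coefficients

variable {𝒪 ks} (s : ResidueGal 𝒪 ks →ₜ* TameGal 𝒪 ks)
  (A : Type*) [CommGroup A] [TopologicalSpace A] [IsTopologicalGroup A]

/-- The group `A(-1) = Hom(I^t, A)`, for a constant module `A`. -/
abbrev NegTwist (𝒪 : ValuationSubring k) [HenselianLocalRing 𝒪]
    (ks : Type*) [Field ks] [Algebra k ks] [IsGalois k ks]
    (A : Type*) [CommGroup A] [TopologicalSpace A] [IsTopologicalGroup A] : Type _ :=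
  TameInertia 𝒪 ks →ₜ* A

/-- The action of `Γ_k₀` on `A(-1)`, where `Γ_k₀` is regarded as a subgroup of `Γ_k^t` through the
section `s`. -/
def negTwistAction : ResidueGal 𝒪 ks →* MulAut (NegTwist 𝒪 ks A) :=
  (homAction (TameInertia 𝒪 ks) A).comp s.toMonoidHom

variable {A}

/-- `β` is a residue of `α`: the class `α` is the inflation of the class of a `2`-cocycle `a` on
`Γ_k^t` which is adapted to `Γ_k^t → Γ_k₀`, and `β` is the class of the residue of `a`. -/
def IsResidue (α : H2 Gal(ks/k) A) (β : H1 (negTwistAction s A)) : Prop :=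
  ∃ (a : Z2 (TameGal 𝒪 ks) A) (ha : IsAdapted (tameToResidueGal 𝒪 ks) a.1),
    H2.pullback (toTameGal 𝒪 ks) (QuotientGroup.mk a) = α ∧
      (QuotientGroup.mk (residueCocycle (tameToResidueGal 𝒪 ks) s a ha) :
        H1 (negTwistAction s A)) = β

open Classical in
/-- The residue map `r_v : H²(k, A) → H¹(k₀, A(-1))`, which is the edge map of the
Hochschild-Serre spectral sequence, described by cocycles. If the order of `A` is prime to the
characteristic of `k₀`, then every class has exactly one residue; the value `1` is a placeholder
in other cases. -/
def residueMap (α : H2 Gal(ks/k) A) : H1 (negTwistAction s A) :=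
  if h : ∃ β, IsResidue s α β then h.choose else 1

end Coefficients

section Cyclotomic

variable {𝒪 ks} {G : Type*} [Group G] [Finite G]

/-- The power `g ^ (χ(γ)⁻¹)`, where `χ` is the cyclotomic character of `k₀` and `g` is an element
of a finite group. Only the reduction of `χ` modulo the order `N` of `g` matters, which is the
character of the action on the `N`-th roots of unity (`N` is meant to be prime to the
characteristic of `k₀`). -/
def powCycloInv (γ : ResidueGal 𝒪 ks) (g : G) : G :=
  haveI : NeZero (orderOf g) := ⟨(orderOf_pos g).ne'⟩
  g ^ ((modularCyclotomicCharacter' (SepResidueField 𝒪 ks) (orderOf g)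
    (γ : SepResidueField 𝒪 ks ≃+* SepResidueField 𝒪 ks))⁻¹).val.val

/-- The element `c_γ = a₀ (γ a₀)^(-χ(γ)⁻¹)` of `G`, where `Γ_k₀` acts on `G` by conjugation
through `φ₀ : Γ_k₀ → G / Z(G)`. -/
def cocycleElement [TopologicalSpace G] (φ₀ : ResidueGal 𝒪 ks →ₜ* G ⧸ Subgroup.center G)
    (a₀ : G) (γ : ResidueGal 𝒪 ks) : G :=
  a₀ * (powCycloInv γ (conjAction G (φ₀ γ) a₀))⁻¹

end Cyclotomic

end Field

end TameResidue

end

open TameResidue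

noncomputable section

namespace TameResidue

open IsLocalRing
open scoped Pointwise

/-! ### Inflation and residues on a split extension. -/

section Cohomology

variable {Γ Q A : Type*} [Group Γ] [TopologicalSpace Γ]
  [Group Q] [TopologicalSpace Q] [CommGroup A] [TopologicalSpace A] [IsTopologicalGroup A]

/-! Wild inertia has no nontrivial continuous homomorphism to `C`, since the order of `C` is prime
to the residue characteristic (`hom_wildInertia_eq_one`). Hence inflation from `Γ_k^t` to `Γ_k` is
injective on `H²(-, C)` (`H2.inflation_injective`), and everything can be computed on the split
extension `Γ_k^t = I^t ⋊ Γ_k₀`.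

The central point is that the restriction of `φ` to `I^t` lifts to a homomorphism `α : I^t → G` with
`α q₀ = a₀`, and that conjugation by `γ⁻¹` moves `α q₀` to its power with exponent `χ(γ)⁻¹`
(`exists_hom_tameInertia`). Such an `α` exists because the order `N` of `a₀` is prime to the residue
characteristic: adjoining an `N`-th root `x` of a uniformizer is totally ramified, so `σ ↦ σ x / x`
gives a character of `I^t` with an element of order `N` in its image, and this image is generated by
the value at `q₀`.

Let `u` be a normalized set-theoretic lift of `φ` on `Γ_k₀`. The lift `s δ * m ↦ u δ * α m` of `φ`
has an adapted cocycle (`exists_isAdapted_obstruction`), whose residue at `γ` is `n ↦ α n * u γ * (α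
(γ⁻¹ n γ))⁻¹ * (u γ)⁻¹`. At `n = q₀` this is `c_γ`. Two adapted cocycles in one class have the same
residue class (`residueCocycle_mk_eq`), so `r_v` is well defined here.

If the residue is the coboundary of some `η`, then `α * η` is another homomorphic lift, for which
the residue cocycle is identically `1`; the cocycle of the obstruction is then the inflation of the
cocycle of `u` (`obstruction_eq_pullback`). Uniqueness holds because the section makes inflation
from `Γ_k₀` to `Γ_k^t` injective. -/

theorem H2.mk_eq_iff {a a' : Z2 Γ A} :
    (QuotientGroup.mk a : H2 Γ A) = QuotientGroup.mk a' ↔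
      ∃ b : Γ → A, Continuous b ∧
        ∀ g h, a.1 (g, h) = a'.1 (g, h) * (b g * b h / b (g * h)) := by
  rw [eq_comm, QuotientGroup.eq]
  change (∃ b : Γ → A, Continuous b ∧ ∀ g h, (a'.1 (g, h))⁻¹ * a.1 (g, h) = _) ↔ _
  simp only [inv_mul_eq_iff_eq_mul]

theorem H2.pullback_comp {Δ : Type*} [Group Δ] [TopologicalSpace Δ] (π : Γ →ₜ* Q) (f : Δ →ₜ* Γ)
    (α : H2 Q A) : H2.pullback f (H2.pullback π α) = H2.pullback (π.comp f) α := by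
  obtain ⟨a, rfl⟩ := QuotientGroup.mk_surjective α
  rfl

theorem H2.pullback_injective_of_section (π : Γ →ₜ* Q) (s : Q →ₜ* Γ) (hs : ∀ γ, π (s γ) = γ) :
    Function.Injective (H2.pullback π : H2 Q A →* H2 Γ A) := by
  refine Function.LeftInverse.injective (g := H2.pullback s) fun α => ?_
  obtain ⟨a, rfl⟩ := QuotientGroup.mk_surjective α
  refine congrArg QuotientGroup.mk (Subtype.ext (funext fun p => ?_))
  change a.1 (π (s p.1), π (s p.2)) = a.1 p
  rw [hs, hs]

/-- Inflation from a quotient by a normal subgroup without homomorphisms to `A` is injective. -/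
theorem H2.inflation_injective (N : Subgroup Γ) [N.Normal] (f : Γ →ₜ* Γ ⧸ N)
    (hf : ∀ g, f g = g) (hN : ∀ η : N →ₜ* A, ∀ n, η n = 1) :
    Function.Injective (H2.pullback f : H2 (Γ ⧸ N) A →* H2 Γ A) := by
  rw [injective_iff_map_eq_one]
  intro α hα
  obtain ⟨c, rfl⟩ := QuotientGroup.mk_surjective α
  obtain ⟨b, hb, hcb⟩ := H2.mk_eq_iff (a := Z2.pullback f c) (a' := 1).1 hα
  replace hcb : ∀ g h, c.1 (f g, f h) = b g * b h / b (g * h) := fun g h => by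
    rw [← one_mul (b g * b h / b (g * h))]; exact hcb g h
  have h1 : ∀ q : Γ ⧸ N, c.1 (q, 1) = b 1 := fun q => by
    have h1 := c.2.2 q 1 1
    rw [mul_one, mul_one, mul_left_inj] at h1
    rw [← h1]
    have := hcb 1 1
    rwa [map_one, mul_one, mul_div_cancel_right] at this
  have hN1 : ∀ n : N, f n = 1 := fun n => by rw [hf]; exact (QuotientGroup.eq_one_iff _).2 n.2
  -- The inflated cocycle is constant, equal to `b 1`, when its second argument lies in `N`. So `b`
  -- is multiplicative there up to this constant, and `b / b 1` is a homomorphism on `N`, trivial by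
  -- hypothesis. Then `b` is constant on cosets of `N` and descends.
  have hmul : ∀ (g : Γ) (n : N), b g * b n = b 1 * b (g * n) := fun g n => by
    rw [← h1 (f g), ← hN1 n, hcb, div_mul_cancel]
  let η : N →ₜ* A :=
    { toFun := fun n => b n / b 1
      map_one' := by simp
      map_mul' := fun n m => by
        rw [Subgroup.coe_mul, div_mul_div_comm, hmul, mul_div_mul_left_eq_div]
      continuous_toFun := (hb.comp continuous_subtype_val).div' continuous_const }
  have hbn : ∀ n : N, b n = b 1 := fun n => div_eq_one.1 (hN η n)
  have hinv : ∀ (g : Γ) (n : N), b (g * n) = b g := fun g n => by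
    have := hmul g n
    rw [hbn, mul_comm (b g)] at this
    exact (mul_left_cancel this).symm
  refine (H2.mk_eq_iff (a := c) (a' := 1)).2 ⟨fun q => Quotient.liftOn' q b fun g h hgh => ?_, ?_, ?_⟩
  · rw [QuotientGroup.leftRel_apply] at hgh
    have := hinv g ⟨_, hgh⟩
    simpa using this.symm
  · exact hb.quotient_liftOn' _
  · intro g h
    obtain ⟨g, rfl⟩ := QuotientGroup.mk_surjective g
    obtain ⟨h, rfl⟩ := QuotientGroup.mk_surjective h
    have := hcb g h
    rw [hf, hf] at this
    rw [this]
    exact (one_mul _).symm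

variable [IsTopologicalGroup Γ]

/-- Two adapted cocycles with the same class have the same residue class. -/
theorem residueCocycle_mk_eq (π : Γ →ₜ* Q) (s : Q →ₜ* Γ) (a a' : Z2 Γ A)
    (ha : IsAdapted π a.1) (ha' : IsAdapted π a'.1)
    (h : (QuotientGroup.mk a : H2 Γ A) = QuotientGroup.mk a') :
    (QuotientGroup.mk (residueCocycle π s a ha) :
      H1 ((homAction π.toMonoidHom.ker A).comp s.toMonoidHom)) =
      QuotientGroup.mk (residueCocycle π s a' ha') := by
  obtain ⟨b, hb, hab⟩ := H2.mk_eq_iff.1 h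
  -- Both cocycles are `1` when the second argument lies in the kernel. The restriction of `b` to
  -- the kernel is therefore a homomorphism, and it is the cochain that relates the two residues.
  have hmul : ∀ (g : Γ) (n : π.toMonoidHom.ker), b (g * n) = b g * b n := by
    intro g n
    have hn : π (n : Γ) = π 1 := by rw [map_one]; exact n.2
    have h1 := hab g n
    rw [ha.factors g n 1 hn, ha.one_right, ha'.factors g n 1 hn, ha'.one_right, one_mul] at h1
    exact (div_eq_one.1 h1.symm).symm
  let η : π.toMonoidHom.ker →ₜ* A :=
    { toFun := fun n => b n
      map_one' := by
        have h1 := hmul 1 1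
        rw [OneMemClass.coe_one, mul_one] at h1
        simpa using h1
      map_mul' := fun n m => hmul n m
      continuous_toFun := hb.comp continuous_subtype_val }
  refine QuotientGroup.eq.2 ⟨η, fun γ => ?_⟩
  ext n
  change (a.1 (n, s γ))⁻¹ * a'.1 (n, s γ) = b (MulAut.conjNormal (s γ)⁻¹ n : π.toMonoidHom.ker) / b n
  have h2 : (n : Γ) * s γ = s γ * (MulAut.conjNormal (s γ)⁻¹ n : π.toMonoidHom.ker) := by
    rw [MulAut.conjNormal_apply]; group
  rw [hab, h2, hmul, div_eq_mul_inv, div_eq_mul_inv, mul_inv, mul_inv, mul_inv, mul_inv, mul_inv,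
    inv_inv, inv_inv]
  set B := b (MulAut.conjNormal (s γ)⁻¹ n : π.toMonoidHom.ker)
  calc _ = ((a'.1 (n, s γ))⁻¹ * a'.1 (n, s γ)) * ((b (s γ))⁻¹ * b (s γ)) * (B * (b n)⁻¹) := by
        ac_rfl
    _ = _ := by simp

/-! ### The lifting obstruction on a split extension. -/

variable {G : Type*} [Group G] [TopologicalSpace G] [DiscreteTopology G]

theorem obstruction_comp {Δ : Type*} [Group Δ] [TopologicalSpace Δ] [ContinuousMul Δ]
    (φ : Γ →ₜ* G ⧸ Subgroup.center G) (f : Δ →ₜ* Γ) :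
    obstruction (φ.comp f) = H2.pullback f (obstruction φ) := by
  have : DiscreteTopology (G ⧸ Subgroup.center G) :=
    QuotientGroup.discreteTopology (isOpen_discrete _)
  rw [obstruction_eq (φ.comp f) (fun g => (φ (f g)).out)
    (continuous_of_discreteTopology.comp (φ.continuous_toFun.comp f.continuous_toFun))
    fun _ => Quotient.out_eq' _]
  refine congrArg QuotientGroup.mk (Subtype.ext (funext fun p => Subtype.ext ?_))
  change _ * _ * (φ (f (p.1 * p.2))).out⁻¹ = _ * _ * (φ (f p.1 * f p.2)).out⁻¹
  rw [map_mul f]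

/-- A cochain `b` that trivializes the class corrects a set-theoretic lift `u` to the homomorphism
`u * b⁻¹`, as `b` is central. Conversely, a homomorphic lift has trivial cocycle. -/
theorem obstruction_eq_one_iff (φ : Γ →ₜ* G ⧸ Subgroup.center G) :
    obstruction φ = 1 ↔ ∃ ψ : Γ →ₜ* G, ∀ g, (ψ g : G ⧸ Subgroup.center G) = φ g := by
  have : DiscreteTopology (G ⧸ Subgroup.center G) :=
    QuotientGroup.discreteTopology (isOpen_discrete _)
  constructor
  · intro h
    obtain ⟨b, hb, hab⟩ := H2.mk_eq_iff (a' := 1).1 h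
    set u : Γ → G := fun g => (φ g).out with hu
    have huc : Continuous u := continuous_of_discreteTopology.comp φ.continuous_toFun
    have key : ∀ g h, u g * u h * (u (g * h))⁻¹ =
        (b g : G) * b h * (b (g * h) : G)⁻¹ := fun g h => by
      have := congrArg Subtype.val (hab g h)
      rw [div_eq_mul_inv] at this
      refine this.trans ?_
      rw [show ((1 : Z2 Γ (Subgroup.center G)).1 (g, h)) = 1 from rfl, one_mul]
      rfl
    refine ⟨ContinuousMonoidHom.mk (MonoidHom.mk' (fun g => u g * ((b g : G))⁻¹) fun g h => ?_) ?_,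
      fun g => ?_⟩
    · have c1 := fun x : G => Subgroup.mem_center_iff.1 (inv_mem (b g).2) x
      have c2 := fun x : G => Subgroup.mem_center_iff.1 (b (g * h)).2 x
      have h1 : u (g * h) = ((b g : G) * b h * ((b (g * h) : G))⁻¹)⁻¹ * (u g * u h) := by
        rw [← key]; group
      rw [h1]
      have c3 := fun x : G => Subgroup.mem_center_iff.1 (inv_mem (b h).2) x
      simp only [mul_inv_rev, inv_inv]
      calc _ = b (g * h) * ((b h : G)⁻¹ * ((b g : G)⁻¹ * (u g * u h)) * (b (g * h) : G)⁻¹) := by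
            simp only [mul_assoc]
        _ = (b h : G)⁻¹ * ((b g : G)⁻¹ * (u g * u h)) := by
            rw [← c2]; group
        _ = _ := by
            rw [← c1 (u g * u h), ← c3, mul_assoc (u g) (b g : G)⁻¹, ← c1]
            simp only [mul_assoc]
            rw [c3]
    · exact huc.mul (continuous_subtype_val.comp hb).inv
    · change ((u g * ((b g : G))⁻¹ : G) : G ⧸ Subgroup.center G) = φ g
      rw [QuotientGroup.mk_mul_of_mem _ (inv_mem (b g).2)]
      exact Quotient.out_eq' _
  · rintro ⟨ψ, hψ⟩
    rw [obstruction_eq φ ψ ψ.continuous_toFun hψ]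
    refine congrArg QuotientGroup.mk (Subtype.ext (funext fun p => Subtype.ext ?_))
    change ψ p.1 * ψ p.2 * (ψ (p.1 * p.2))⁻¹ = 1
    rw [map_mul, mul_inv_cancel]

/-- For a split extension, a lift of `φ` on the quotient and a homomorphic lift of `φ` on the
kernel give an adapted cocycle that represents the obstruction. -/
theorem exists_isAdapted_obstruction (π : Γ →ₜ* Q) (s : Q →ₜ* Γ) (hs : ∀ γ, π (s γ) = γ)
    (φ : Γ →ₜ* G ⧸ Subgroup.center G) (u : Q → G) (hu : Continuous u) (hu1 : u 1 = 1)
    (huφ : ∀ γ, (u γ : G ⧸ Subgroup.center G) = φ (s γ))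
    (α : π.toMonoidHom.ker →ₜ* G) (hα : ∀ n, (α n : G ⧸ Subgroup.center G) = φ n) :
    ∃ (a : Z2 Γ (Subgroup.center G)) (_ : IsAdapted π a.1),
      (QuotientGroup.mk a : H2 Γ (Subgroup.center G)) = obstruction φ ∧
      ∀ δ m γ, (a.1 (s δ * (m : π.toMonoidHom.ker), s γ) : G) =
        u δ * α m * u γ * (α (MulAut.conjNormal (s γ)⁻¹ m))⁻¹ * (u (δ * γ))⁻¹ := by
  have hker : ∀ g, (s (π g))⁻¹ * g ∈ π.toMonoidHom.ker := fun g => by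
    change π _ = 1
    rw [map_mul, map_inv, hs, inv_mul_cancel]
  -- This is the decomposition `g = s (π g) * m` with `m` in the kernel, with `s` replaced by `u`
  -- and `m` by `α m`.
  set w : Γ → G := fun g => u (π g) * α ⟨_, hker g⟩ with hw
  have hwc : Continuous w :=
    (hu.comp π.continuous_toFun).mul (α.continuous_toFun.comp (Continuous.subtype_mk
      ((s.continuous_toFun.comp π.continuous_toFun).inv.mul continuous_id) _))
  have hwφ : ∀ g, (w g : G ⧸ Subgroup.center G) = φ g := fun g => by
    rw [hw, QuotientGroup.mk_mul, huφ, hα, ← map_mul, mul_inv_cancel_left]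
  have hws : ∀ δ (m : π.toMonoidHom.ker), w (s δ * m) = u δ * α m := fun δ m => by
    have h1 : π (s δ * m) = δ := by
      rw [map_mul, hs, show π (m : Γ) = 1 from m.2, mul_one]
    have h2 : (⟨_, hker (s δ * m)⟩ : π.toMonoidHom.ker) = m := Subtype.ext (by
      change (s (π (s δ * m)))⁻¹ * (s δ * m) = m
      rw [h1, inv_mul_cancel_left])
    rw [hw]
    change u (π (s δ * m)) * α ⟨_, hker (s δ * m)⟩ = _
    rw [h2, h1]
  have hdec : ∀ g, ∃ δ, ∃ m : π.toMonoidHom.ker, g = s δ * m := fun g =>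
    ⟨π g, ⟨_, hker g⟩, by simp⟩
  have hcomm : ∀ (m : π.toMonoidHom.ker) γ,
      (m : Γ) * s γ = s γ * (MulAut.conjNormal (s γ)⁻¹ m : π.toMonoidHom.ker) := fun m γ => by
    rw [MulAut.conjNormal_apply]; group
  -- Since `α` is multiplicative, the factor `α n` cancels. The cocycle thus depends on its second
  -- argument `s γ * n` only through `γ`, which is adaptedness.
  have key : ∀ δ (m : π.toMonoidHom.ker) γ (n : π.toMonoidHom.ker),
      w (s δ * m) * w (s γ * n) * (w (s δ * m * (s γ * n)))⁻¹ =
        u δ * α m * u γ * (α (MulAut.conjNormal (s γ)⁻¹ m))⁻¹ * (u (δ * γ))⁻¹ := by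
    intro δ m γ n
    have h1 : s δ * (m : Γ) * (s γ * n) =
        s (δ * γ) * ((MulAut.conjNormal (s γ)⁻¹ m * n : π.toMonoidHom.ker) : Γ) := by
      rw [map_mul, Subgroup.coe_mul, mul_assoc, ← mul_assoc (m : Γ), hcomm]
      simp only [mul_assoc]
    rw [h1, hws, hws, hws, map_mul α]
    group
  refine ⟨liftCocycle φ w hwc hwφ, ⟨fun g => ?_, fun g => ?_, fun g h h' hh => ?_⟩,
    (obstruction_eq φ w hwc hwφ).symm, fun δ m γ => ?_⟩
  · obtain ⟨γ, n, rfl⟩ := hdec g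
    refine Subtype.ext ?_
    have := key 1 1 γ n
    simp only [map_one, OneMemClass.coe_one, mul_one, hu1, one_mul, inv_one] at this
    change w 1 * w _ * (w (1 * _))⁻¹ = 1
    rw [one_mul (s γ * _), this, mul_inv_cancel]
  · obtain ⟨δ, m, rfl⟩ := hdec g
    refine Subtype.ext ?_
    have := key δ m 1 1
    simp only [map_one, OneMemClass.coe_one, mul_one, hu1, inv_one, MulAut.one_apply] at this
    change w _ * w 1 * (w (_ * 1))⁻¹ = 1
    rw [mul_one (s δ * _), this]
    group
  · obtain ⟨δ, m, rfl⟩ := hdec g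
    obtain ⟨γ, n, rfl⟩ := hdec h
    obtain ⟨γ', n', rfl⟩ := hdec h'
    have h1 : γ = γ' := by
      have h2 : ∀ γ (n : π.toMonoidHom.ker), π (s γ * n) = γ := fun γ n => by
        rw [map_mul, hs, show π (n : Γ) = 1 from n.2, mul_one]
      rwa [h2, h2] at hh
    subst h1
    exact Subtype.ext ((key δ m γ n).trans (key δ m γ n').symm)
  · have := key δ m γ 1
    rw [OneMemClass.coe_one, mul_one] at this
    exact this

/-- The hypothesis `hαu` says that the residue cocycle is `1` on the nose. The factors `α` then
disappear from the adapted cocycle, and what remains is the cocycle of `u`. -/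
theorem obstruction_eq_pullback (π : Γ →ₜ* Q) (s : Q →ₜ* Γ) (hs : ∀ γ, π (s γ) = γ)
    [ContinuousMul Q]
    (φ : Γ →ₜ* G ⧸ Subgroup.center G) (u : Q → G) (hu : Continuous u) (hu1 : u 1 = 1)
    (huφ : ∀ γ, (u γ : G ⧸ Subgroup.center G) = φ (s γ))
    (α : π.toMonoidHom.ker →ₜ* G) (hα : ∀ n, (α n : G ⧸ Subgroup.center G) = φ n)
    (hαu : ∀ m γ, α m * u γ * (α (MulAut.conjNormal (s γ)⁻¹ m))⁻¹ = u γ) :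
    obstruction φ = H2.pullback π (obstruction (φ.comp s)) := by
  obtain ⟨a, ha, hmk, hval⟩ := exists_isAdapted_obstruction π s hs φ u hu hu1 huφ α hα
  rw [← hmk, obstruction_eq (φ.comp s) u hu huφ]
  refine congrArg QuotientGroup.mk (Subtype.ext (funext fun p => Subtype.ext ?_))
  obtain ⟨g, h⟩ := p
  change (a.1 (g, h) : G) = u (π g) * u (π h) * (u (π g * π h))⁻¹
  have hm : (s (π g))⁻¹ * g ∈ π.toMonoidHom.ker := by
    change π _ = 1
    rw [map_mul, map_inv, hs, inv_mul_cancel]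
  have h1 := hval (π g) ⟨_, hm⟩ (π h)
  rw [mul_inv_cancel_left] at h1
  rw [ha.factors g h (s (π h)) (hs _).symm, h1, mul_assoc (u (π g)), mul_assoc (u (π g)), hαu]

end Cohomology

/-! ### Open sets and powers in the Krull topology. -/

section GaloisAction

variable {k ks : Type*} [Field k] [Field ks] [Algebra k ks] [IsGalois k ks]

/-- The value `σ x` is constant on left cosets of the open subgroup that fixes `k(x)`. As `S` is
arbitrary, such sets are also closed. -/
theorem isOpen_setOf_apply_mem (x : ks) (S : Set ks) : IsOpen {σ : Gal(ks/k) | σ x ∈ S} := by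
  have hfin : FiniteDimensional k (IntermediateField.adjoin k {x}) :=
    IntermediateField.adjoin.finiteDimensional (Algebra.IsIntegral.isIntegral x)
  refine isOpen_iff_mem_nhds.2 fun σ hσ => ?_
  have hopen : IsOpen {τ : Gal(ks/k) | σ⁻¹ * τ ∈ (IntermediateField.adjoin k {x}).fixingSubgroup} :=
    (IntermediateField.fixingSubgroup_isOpen _).preimage (continuous_const_mul σ⁻¹)
  refine Filter.mem_of_superset (hopen.mem_nhds (by simp)) fun τ hτ => ?_
  have h1 : (σ⁻¹ * τ) x = x := hτ ⟨x, IntermediateField.mem_adjoin_simple_self k x⟩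
  have h2 : τ x = σ x := by
    rw [AlgEquiv.mul_apply] at h1
    nth_rw 2 [← h1]
    rw [← AlgEquiv.mul_apply, mul_inv_cancel, AlgEquiv.one_apply]
  rw [Set.mem_ofPred_eq, h2]
  exact hσ

theorem isClosed_setOf_apply_mem (x : ks) (S : Set ks) : IsClosed {σ : Gal(ks/k) | σ x ∈ S} :=
  ⟨isOpen_setOf_apply_mem x Sᶜ⟩

theorem exists_pow_mem_of_isOpen (U : Subgroup Gal(ks/k)) (hU : IsOpen (U : Set Gal(ks/k)))
    (σ : Gal(ks/k)) : ∃ n, 0 < n ∧ σ ^ n ∈ U := by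
  have := U.quotient_finite_of_isOpen hU
  have := Subgroup.finiteIndex_of_finite_quotient (H := U)
  obtain ⟨n, hn, -, h⟩ := Subgroup.exists_pow_mem_of_index_ne_zero this.index_ne_zero σ
  exact ⟨n, hn, h⟩

theorem exists_pow_apply_eq (σ : Gal(ks/k)) (x : ks) : ∃ n, 0 < n ∧ (σ ^ n) x = x := by
  have hfin : FiniteDimensional k (IntermediateField.adjoin k {x}) :=
    IntermediateField.adjoin.finiteDimensional (Algebra.IsIntegral.isIntegral x)
  obtain ⟨n, hn, h⟩ := exists_pow_mem_of_isOpen _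
    (IntermediateField.fixingSubgroup_isOpen (IntermediateField.adjoin k {x})) σ
  exact ⟨n, hn, h ⟨x, IntermediateField.mem_adjoin_simple_self k x⟩⟩

end GaloisAction

theorem isIntegral_apply {k ks : Type*} [Field k] [Field ks] [Algebra k ks]
    (𝒪 : ValuationSubring k) (σ : Gal(ks/k)) {x : ks} (hx : IsIntegral 𝒪 x) :
    IsIntegral 𝒪 (σ x) :=
  (σ • (⟨x, hx⟩ : integralClosure 𝒪 ks)).2

/-! ### Wild inertia and integrality in the separable closure. -/

section Field

variable {k : Type*} [Field k] (𝒪 : ValuationSubring k) [HenselianLocalRing 𝒪]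
  (ks : Type*) [Field ks] [Algebra k ks] [IsGalois k ks]

theorem natCast_sepResidueField_ne_zero {n : ℕ} (hn : (n : BaseResidueField 𝒪) ≠ 0) :
    (n : SepResidueField 𝒪 ks) ≠ 0 := by
  rw [← map_natCast (algebraMap (BaseResidueField 𝒪) (SepResidueField 𝒪 ks))]
  exact (map_ne_zero _).2 hn

/-- This makes inertia closed in `Γ_k`, which a later compactness argument needs. -/
theorem t2Space_residueGal [CharZero k] [IsSepClosure k ks] [PerfectField (BaseResidueField 𝒪)] :
    T2Space (ResidueGal 𝒪 ks) := by
  have : Algebra.IsSeparable (BaseResidueField 𝒪) (SepResidueField 𝒪 ks) :=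
    IsSepClosure.separable
  have : Algebra.IsIntegral (BaseResidueField 𝒪) (SepResidueField 𝒪 ks) :=
    ⟨fun x => Algebra.IsSeparable.isIntegral _ x⟩
  exact krullTopology_t2

variable {𝒪 ks} in
theorem add_ne_zero_of_mem_maximalIdeal {n : ℕ} (hn : (n : BaseResidueField 𝒪) ≠ 0)
    {y : integralClosure 𝒪 ks} (hy : y ∈ maximalIdeal (integralClosure 𝒪 ks)) :
    ((n + y : integralClosure 𝒪 ks) : ks) ≠ 0 := by
  intro h
  have h1 : (n + y : integralClosure 𝒪 ks) = 0 := Subtype.ext h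
  have h2 := congrArg (residue (integralClosure 𝒪 ks)) h1
  rw [map_add, (residue_eq_zero_iff y).2 hy, add_zero, map_natCast, map_zero] at h2
  exact natCast_sepResidueField_ne_zero 𝒪 ks hn h2

variable {𝒪 ks} in
/-- Wild inertia has no elements of finite order prime to the residue characteristic. -/
theorem apply_eq_of_mem_wildInertia {σ : Gal(ks/k)} (hσ : σ ∈ wildInertia 𝒪 ks) {n : ℕ}
    (hn : (n : BaseResidueField 𝒪) ≠ 0) {x : ks} (hx : (σ ^ n) x = x) : σ x = x := by
  -- The sum telescopes to `σ ^ n x - x`. On the other hand each term is `(σ x - x) * (1 + z i)`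
  -- with `z i` in the maximal ideal, so the sum is `σ x - x` times a number with residue `n ≠ 0`.
  have h1 : ∑ i ∈ Finset.range n, (σ ^ i) (σ x - x) = 0 := by
    have h2 : ∀ i, (σ ^ i) (σ x - x) = (σ ^ (i + 1)) x - (σ ^ i) x := fun i => by
      rw [map_sub, pow_succ, AlgEquiv.mul_apply]
    simp only [h2]
    rw [Finset.sum_range_sub (fun i => (σ ^ i) x), hx, pow_zero, AlgEquiv.one_apply, sub_self]
  choose z hz hz' using fun i : ℕ => pow_mem hσ i (σ x - x)
  have h3 : (σ x - x) * ((n + ∑ i ∈ Finset.range n, z i : integralClosure 𝒪 ks) : ks) = 0 := by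
    rw [← h1]
    simp only [hz']
    push_cast
    rw [← Finset.mul_sum, Finset.sum_add_distrib]
    simp
  rcases mul_eq_zero.1 h3 with h | h
  · exact sub_eq_zero.1 h
  · exact (add_ne_zero_of_mem_maximalIdeal hn (sum_mem fun i _ => hz i) h).elim

/-- Wild inertia has no continuous homomorphisms to finite groups of order prime to the residue
characteristic. -/
theorem hom_wildInertia_eq_one {A : Type*} [Group A] [TopologicalSpace A]
    [DiscreteTopology A] (hA : (Nat.card A : BaseResidueField 𝒪) ≠ 0)
    (f : wildInertia 𝒪 ks →ₜ* A) (σ : wildInertia 𝒪 ks) : f σ = 1 := by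
  by_contra hne
  have hd : orderOf (f σ) ≠ 1 := by rwa [ne_eq, orderOf_eq_one_iff]
  obtain ⟨l, hl, hld⟩ := Nat.exists_prime_and_dvd hd
  have hl0 : (l : BaseResidueField 𝒪) ≠ 0 := by
    obtain ⟨c, hc⟩ := hld.trans (orderOf_dvd_natCard (f σ))
    intro h
    rw [hc, Nat.cast_mul, h, zero_mul] at hA
    exact hA rfl
  have hker : IsOpen (f ⁻¹' {1}) := (isOpen_discrete _).preimage f.continuous_toFun
  obtain ⟨V, hV, hVker⟩ := isOpen_induced_iff.1 hker
  have hV1 : V ∈ nhds (1 : Gal(ks/k)) := hV.mem_nhds (by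
    have : (1 : wildInertia 𝒪 ks) ∈ Subtype.val ⁻¹' V := by rw [hVker]; exact map_one f
    exact this)
  obtain ⟨E, hE, hEV⟩ := (krullTopology_mem_nhds_one_iff _ _ _).1 hV1
  obtain ⟨e, he, heE⟩ := exists_pow_mem_of_isOpen _ (IntermediateField.fixingSubgroup_isOpen E)
    (σ : Gal(ks/k))
  -- On `E` the power `σ ^ r` has order dividing `l ^ a`, which is prime to the residue
  -- characteristic, so it fixes `E` and `f σ ^ r = 1`. But `l` divides the order of `f σ` and not
  -- `r`.
  obtain ⟨a, r, hr, rfl⟩ := Nat.exists_eq_pow_mul_and_not_dvd he.ne' l hl.ne_one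
  have h1 : (σ : Gal(ks/k)) ^ r ∈ E.fixingSubgroup := fun x => by
    refine apply_eq_of_mem_wildInertia (pow_mem σ.2 r) (n := l ^ a)
      (by rw [Nat.cast_pow]; exact pow_ne_zero _ hl0) ?_
    rw [← pow_mul, mul_comm]
    exact heE x
  have h2 : σ ^ r ∈ Subtype.val ⁻¹' V := hEV h1
  rw [hVker] at h2
  have h3 : f σ ^ r = 1 := by rw [← map_pow]; exact h2
  exact hr (hld.trans (orderOf_dvd_of_pow_eq_one h3))

/-- In a finite Galois subextension that contains `x`, the integral closure of `𝒪` is a Dedekind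
domain, and it is local because `𝒪` is henselian. So it is a valuation ring. -/
theorem isIntegral_or_isIntegral_inv [CharZero k] [IsDiscreteValuationRing 𝒪] (x : ks) :
    IsIntegral 𝒪 x ∨ IsIntegral 𝒪 x⁻¹ := by
  let E := FiniteGaloisIntermediateField.adjoin k ({x} : Set ks)
  have hx : x ∈ E.toIntermediateField := FiniteGaloisIntermediateField.subset_adjoin k _ rfl
  have := isLocalRing_integralClosure 𝒪 k E
  have := integralClosure.isFractionRing_of_finite_extension (A := 𝒪) k E
  have : IsDedekindDomain (integralClosure 𝒪 E) := integralClosure.isDedekindDomain 𝒪 k E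
  have : ValuationRing (integralClosure 𝒪 E) :=
    ValuationRing.iff_local_bezout_domain.2 ⟨inferInstance, inferInstance⟩
  let φ : E →ₐ[𝒪] ks := (E.val).restrictScalars 𝒪
  rcases (ValuationRing.isInteger_or_isInteger (integralClosure 𝒪 E) (⟨x, hx⟩ : E)) with h | h
  · obtain ⟨y, hy⟩ := h
    refine Or.inl ?_
    have := y.2.map φ
    change (y : E) = _ at hy
    rw [hy] at this
    exact this
  · obtain ⟨y, hy⟩ := h
    refine Or.inr ?_
    have := y.2.map φ
    change (y : E) = _ at hy
    rw [hy, map_inv₀] at this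
    exact this

/-- An automorphism preserves the valuation. If `x / σ x` is integral, so are its conjugates, and as
some power of `σ` fixes `x`, a product of these telescopes to `σ x / x`. -/
theorem isIntegral_apply_div [CharZero k] [IsDiscreteValuationRing 𝒪] (σ : Gal(ks/k)) (x : ks) :
    IsIntegral 𝒪 (σ x / x) := by
  rcases isIntegral_or_isIntegral_inv 𝒪 ks (σ x / x) with h | h
  · exact h
  rcases eq_or_ne x 0 with rfl | hx
  · simpa using isIntegral_zero
  obtain ⟨n, hn, hnx⟩ := exists_pow_apply_eq σ x
  obtain ⟨m, rfl⟩ := Nat.exists_eq_succ_of_ne_zero hn.ne'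
  rw [inv_div] at h
  have hne : ∀ i : ℕ, (σ ^ i) x ≠ 0 := fun i => (map_ne_zero (σ ^ i)).2 hx
  have h1 : ∀ m : ℕ, ∏ i ∈ Finset.range m, (σ ^ (i + 1)) (x / σ x) = σ x / (σ ^ (m + 1)) x := by
    intro m
    induction m with
    | zero => rw [Finset.prod_range_zero, pow_one, div_self (by simpa using hx)]
    | succ m ih =>
      rw [Finset.prod_range_succ, ih, map_div₀, ← AlgEquiv.mul_apply, ← pow_succ,
        div_mul_div_cancel₀ (hne _)]
  rw [Nat.succ_eq_add_one] at hnx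
  have h2 := h1 m
  rw [hnx] at h2
  rw [← h2]
  exact IsIntegral.prod _ fun i _ => isIntegral_apply 𝒪 _ h

/-! ### The residue of `σ x / x` and orders of inertia elements. -/

section Ratio

variable [CharZero k] [IsDiscreteValuationRing 𝒪] {ks}

/-- The residue of `σ x / x`. -/
def residueRatio (x : ks) (σ : Gal(ks/k)) : SepResidueField 𝒪 ks :=
  residue _ (⟨σ x / x, isIntegral_apply_div 𝒪 ks σ x⟩ : integralClosure 𝒪 ks)

variable {𝒪} {x : ks}

theorem residueRatio_mul (hx : x ≠ 0) (σ τ : Gal(ks/k)) :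
    residueRatio 𝒪 x (σ * τ) =
      residueRatio 𝒪 x σ * toResidueGal 𝒪 ks σ (residueRatio 𝒪 x τ) := by
  rw [residueRatio, residueRatio, residueRatio, toResidueGal_residue, ← map_mul]
  refine congrArg _ (Subtype.ext ?_)
  rw [Subalgebra.coe_mul, integralClosure.coe_smul, AlgEquiv.smul_def]
  change σ (τ x) / x = σ x / x * σ (τ x / x)
  rw [map_div₀]
  have : σ x ≠ 0 := by simpa using hx
  field_simp

theorem residueRatio_one (hx : x ≠ 0) : residueRatio 𝒪 x 1 = 1 := by
  rw [residueRatio, ← map_one (residue (integralClosure 𝒪 ks))]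
  exact congrArg _ (Subtype.ext (div_self hx))

theorem residueRatio_eq_one_iff (hx : x ≠ 0) (σ : Gal(ks/k)) :
    residueRatio 𝒪 x σ = 1 ↔
      ∃ y ∈ maximalIdeal (integralClosure 𝒪 ks), σ x = x * (1 + y) := by
  rw [residueRatio, ← map_one (residue (integralClosure 𝒪 ks)), ← sub_eq_zero, ← map_sub,
    residue_eq_zero_iff]
  constructor
  · intro h
    refine ⟨_, h, ?_⟩
    push_cast
    field_simp
    ring
  · rintro ⟨y, hy, h⟩
    convert hy
    refine Subtype.ext ?_
    push_cast
    rw [h]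
    field_simp
    ring

theorem residueRatio_pow (hx : x ≠ 0) {σ : Gal(ks/k)} (hσ : toResidueGal 𝒪 ks σ = 1) (n : ℕ) :
    residueRatio 𝒪 x (σ ^ n) = residueRatio 𝒪 x σ ^ n := by
  induction n with
  | zero => rw [pow_zero, pow_zero, residueRatio_one hx]
  | succ n ih =>
    rw [pow_succ, residueRatio_mul hx, map_pow, hσ, one_pow, ih, pow_succ, AlgEquiv.one_apply]

/-- In characteristic `q` the only root of unity of order a power of `q` is `1`, so the `q`-part of
`n` can be dropped. -/
theorem exists_natCast_ne_zero_and_pow_eq_one {F : Type*} [Field F] {u : F} {n : ℕ} (hn : 0 < n)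
    (hu : u ^ n = 1) : ∃ m : ℕ, (m : F) ≠ 0 ∧ u ^ m = 1 := by
  obtain ⟨q, hq⟩ := ExpChar.exists F
  rcases hq with _ | hq
  · exact ⟨n, Nat.cast_ne_zero.2 hn.ne', hu⟩
  · rename_i hchar
    obtain ⟨a, r, hr, rfl⟩ := Nat.exists_eq_pow_mul_and_not_dvd hn.ne' q hq.ne_one
    have : Fact q.Prime := ⟨hq⟩
    refine ⟨r, fun h => hr ((CharP.cast_eq_zero_iff F q r).1 h), ?_⟩
    rw [mul_comm, pow_mul] at hu
    rw [← sub_eq_zero]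
    refine (pow_eq_zero_iff (n := q ^ a) (pow_pos hq.pos _).ne').1 ?_
    rw [sub_pow_char_pow, hu, one_pow, sub_self]

theorem exists_residueRatio_pow_eq_one (hx : x ≠ 0) {σ : Gal(ks/k)}
    (hσ : toResidueGal 𝒪 ks σ = 1) :
    ∃ m : ℕ, (m : BaseResidueField 𝒪) ≠ 0 ∧ residueRatio 𝒪 x (σ ^ m) = 1 := by
  obtain ⟨n, hn, hnx⟩ := exists_pow_apply_eq σ x
  have h1 : residueRatio 𝒪 x σ ^ n = 1 := by
    rw [← residueRatio_pow hx hσ, residueRatio_eq_one_iff hx]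
    exact ⟨0, zero_mem _, by simpa using hnx⟩
  obtain ⟨m, hm, hm'⟩ := exists_natCast_ne_zero_and_pow_eq_one hn h1
  refine ⟨m, fun h => hm ?_, by rw [residueRatio_pow hx hσ, hm']⟩
  rw [← map_natCast (algebraMap (BaseResidueField 𝒪) (SepResidueField 𝒪 ks)), h, map_zero]

/-- The image of an element of inertia under a homomorphism to a discrete group that is trivial on
wild inertia has order prime to the residue characteristic. -/
theorem exists_pow_eq_one_of_toResidueGal_eq_one {H : Type*} [Group H] [TopologicalSpace H]
    [DiscreteTopology H] (φ : Gal(ks/k) →ₜ* H) (hφ : ∀ σ ∈ wildInertia 𝒪 ks, φ σ = 1)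
    [IsSepClosure k ks] [PerfectField (BaseResidueField 𝒪)]
    {σ : Gal(ks/k)} (hσ : toResidueGal 𝒪 ks σ = 1) :
    ∃ m : ℕ, (m : BaseResidueField 𝒪) ≠ 0 ∧ φ σ ^ m = 1 := by
  have : T1Space (ResidueGal 𝒪 ks) := @T2Space.t1Space _ _ (t2Space_residueGal 𝒪 ks)
  have hI : IsClosed {τ : Gal(ks/k) | toResidueGal 𝒪 ks τ = 1} :=
    isClosed_singleton.preimage (toResidueGal 𝒪 ks).continuous_toFun
  have hφ1 : IsClosed {τ : Gal(ks/k) | φ τ ≠ 1} :=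
    (isClosed_discrete {h : H | h ≠ 1}).preimage φ.continuous_toFun
  -- An inertia element whose ratios are all `1` is wild and is killed by `φ`. By compactness,
  -- finitely many `x` already force this; the product of the exponents `m x` makes the
  -- corresponding ratios of the power of `σ` trivial.
  obtain ⟨t, ht⟩ := (hI.inter hφ1).isCompact.elim_finite_subfamily_closed
    (fun x : ksˣ => {τ : Gal(ks/k) | residueRatio 𝒪 (x : ks) τ = 1}) (fun x => by
      simp only [residueRatio_eq_one_iff x.ne_zero]
      exact isClosed_setOf_apply_mem (x : ks)
        {z | ∃ y ∈ maximalIdeal (integralClosure 𝒪 ks), z = x * (1 + y)}) (by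
      refine Set.eq_empty_of_forall_notMem fun τ hτ => hτ.1.2 (hφ τ fun x => ?_)
      rcases eq_or_ne x 0 with rfl | hx
      · exact ⟨0, zero_mem _, by simp⟩
      · exact (residueRatio_eq_one_iff hx τ).1 (Set.mem_iInter.1 hτ.2 (Units.mk0 x hx)))
  choose m hm hm' using fun x : ksˣ => exists_residueRatio_pow_eq_one (𝒪 := 𝒪) x.ne_zero hσ
  refine ⟨∏ x ∈ t, m x, ?_, ?_⟩
  · rw [Nat.cast_prod]
    exact Finset.prod_ne_zero_iff.2 fun x _ => hm x
  · by_contra hne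
    have h1 : σ ^ (∏ x ∈ t, m x) ∈ (∅ : Set Gal(ks/k)) := by
      rw [← ht]
      refine ⟨⟨?_, ?_⟩, Set.mem_iInter₂.2 fun x hx => ?_⟩
      · rw [Set.mem_ofPred_eq, map_pow, hσ, one_pow]
      · rw [Set.mem_ofPred_eq, map_pow]
        exact hne
      · obtain ⟨c, hc⟩ := Finset.dvd_prod_of_mem m hx
        rw [Set.mem_ofPred_eq, hc, residueRatio_pow x.ne_zero hσ, pow_mul,
          ← residueRatio_pow x.ne_zero hσ, hm', one_pow]
    exact h1

end Ratio

end Field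

/-! ### Lifting residue automorphisms and roots of unity. -/

theorem exists_smul_residue_eq {B G : Type*} [CommRing B] [IsLocalRing B] [Group G]
    [TopologicalSpace G] [CompactSpace G] [TotallyDisconnectedSpace G] [IsTopologicalGroup G]
    [MulSemiringAction G B] (hopen : ∀ b : B, IsOpen {g : G | g • b = b})
    (γ : ResidueField B ≃+* ResidueField B)
    (hγ : ∀ b : B, (∀ g : G, g • b = b) → γ (residue B b) = residue B b) :
    ∃ g : G, ∀ b, residue B (g • b) = γ (residue B b) := by
  -- With the discrete topology on `B`, open stabilizers mean a continuous action. The decomposition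
  -- group of the maximal ideal then surjects onto the automorphisms of the residue field over the
  -- residue ring of the fixed ring.
  let : TopologicalSpace B := ⊥
  have : DiscreteTopology B := ⟨rfl⟩
  have : ContinuousSMul G B := by
    refine ⟨continuous_iff_continuousAt.2 fun p => ?_⟩
    refine ContinuousAt.congr (f := fun _ => p.1 • p.2) continuousAt_const ?_
    have h1 : IsOpen {q : G × B | p.1⁻¹ * q.1 ∈ {g : G | g • p.2 = p.2} ∧ q.2 ∈ ({p.2} : Set B)} :=
      (((hopen p.2).preimage (continuous_const_mul p.1⁻¹)).preimage continuous_fst).inter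
        ((isOpen_discrete ({p.2} : Set B)).preimage continuous_snd)
    filter_upwards [h1.mem_nhds ⟨by simp, rfl⟩] with q hq
    have h2 : (p.1⁻¹ * q.1) • p.2 = p.2 := hq.1
    rw [Set.mem_singleton_iff.1 hq.2, ← inv_smul_eq_iff.1 ((mul_smul _ _ _).symm.trans h2)]
  let A := FixedPoints.subring B G
  have : Algebra.IsInvariant A B G := ⟨fun b hb => ⟨⟨b, hb⟩, rfl⟩⟩
  have : SMulCommClass G A B := ⟨fun g a b => by
    rw [Algebra.smul_def, Algebra.smul_def, smul_mul']
    congr 1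
    exact a.2 g⟩
  let P := (maximalIdeal B).under A
  let σ : (B ⧸ maximalIdeal B) ≃ₐ[A ⧸ P] (B ⧸ maximalIdeal B) :=
    AlgEquiv.ofRingEquiv (f := γ) fun a => by
      obtain ⟨a, rfl⟩ := Ideal.Quotient.mk_surjective a
      exact hγ (a : B) a.2
  obtain ⟨g, hg⟩ :=
    Ideal.Quotient.stabilizerHom_surjective_of_profinite (G := G) P (maximalIdeal B) σ
  exact ⟨g, fun b => DFunLike.congr_fun hg (Ideal.Quotient.mk (maximalIdeal B) b)⟩

/-- If `w ≠ 1`, the geometric sum of `w` vanishes, while its residue is `N ≠ 0`. -/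
theorem eq_one_of_pow_eq_one_of_residue_eq_one {k ks : Type*} [Field k] [Field ks] [Algebra k ks]
    [IsGalois k ks] {𝒪 : ValuationSubring k} [HenselianLocalRing 𝒪] {N : ℕ}
    (hN : (N : BaseResidueField 𝒪) ≠ 0)
    {w : integralClosure 𝒪 ks} (hw : w ^ N = 1) (hw1 : residue (integralClosure 𝒪 ks) w = 1) :
    w = 1 := by
  have h1 := mul_geom_sum w N
  rw [hw, sub_self] at h1
  rcases mul_eq_zero.1 h1 with h | h
  · exact sub_eq_zero.1 h
  · have h2 := congrArg (residue (integralClosure 𝒪 ks)) h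
    rw [map_sum] at h2
    simp only [map_pow, hw1, one_pow, Finset.sum_const, Finset.card_range, nsmul_eq_mul, mul_one,
      map_zero] at h2
    exact (natCast_sepResidueField_ne_zero 𝒪 ks hN h2).elim

/-! ### Roots of a uniformizer: total ramification and the action of inertia. -/

section Eisenstein

open Polynomial

variable {k ks : Type*} [Field k] [Field ks] [Algebra k ks] {𝒪 : ValuationSubring k}
  {ϖ : 𝒪} {x : ks} {N : ℕ}

theorem isIntegral_of_pow_eq (hN : N ≠ 0) (hx : x ^ N = algebraMap 𝒪 ks ϖ) : IsIntegral 𝒪 x :=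
  ⟨X ^ N - C ϖ, monic_X_pow_sub_C ϖ hN, by simp [hx]⟩

variable [IsDiscreteValuationRing 𝒪]

theorem isEisensteinAt_X_pow_sub_C (hϖ : Irreducible ϖ) (hN : N ≠ 0) :
    (X ^ N - C ϖ : 𝒪[X]).IsEisensteinAt (Ideal.span {ϖ}) := by
  have hp : Prime ϖ := hϖ.prime
  refine (monic_X_pow_sub_C ϖ hN).isEisensteinAt_of_mem_of_notMem ?_ ?_ ?_
  · rw [ne_eq, Ideal.span_singleton_eq_top]
    exact hϖ.not_isUnit
  · intro n hn
    rw [natDegree_X_pow_sub_C] at hn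
    rw [coeff_sub, coeff_X_pow, if_neg hn.ne, zero_sub, coeff_C]
    split_ifs
    · exact neg_mem (Ideal.mem_span_singleton_self ϖ)
    · simp
  · rw [coeff_sub, coeff_X_pow, if_neg hN.symm, zero_sub, coeff_C_zero, neg_mem_iff,
      Ideal.span_singleton_pow, Ideal.mem_span_singleton]
    rintro ⟨c, hc⟩
    refine hϖ.not_isUnit (IsUnit.of_mul_eq_one c (mul_left_cancel₀ hϖ.ne_zero ?_))
    rw [mul_one, ← mul_assoc, ← pow_two, ← hc]

theorem irreducible_X_pow_sub_C (hϖ : Irreducible ϖ) (hN : N ≠ 0) :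
    Irreducible (X ^ N - C ϖ : 𝒪[X]) := by
  refine (isEisensteinAt_X_pow_sub_C hϖ hN).irreducible ?_
    (monic_X_pow_sub_C ϖ hN).isPrimitive (by rw [natDegree_X_pow_sub_C]; exact hN.bot_lt)
  exact (Ideal.span_singleton_prime hϖ.ne_zero).2 hϖ.prime

theorem minpoly_eq_map_X_pow_sub_C (hϖ : Irreducible ϖ) (hN : N ≠ 0)
    (hx : x ^ N = algebraMap 𝒪 ks ϖ) :
    minpoly k x = (X ^ N - C ϖ : 𝒪[X]).map (algebraMap 𝒪 k) := by
  have hm := monic_X_pow_sub_C ϖ hN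
  refine (minpoly.eq_of_irreducible_of_monic
    ((hm.irreducible_iff_irreducible_map_fraction_map).1 (irreducible_X_pow_sub_C hϖ hN)) ?_
    (hm.map _)).symm
  rw [aeval_map_algebraMap]
  simp [hx]

/-- The discriminant of the power basis multiplies `z` into `𝒪[x]`, and it is a unit times a power
of `ϖ`. That power can be cancelled because the minimal polynomial is Eisenstein at `ϖ`. -/
theorem mem_adjoin_of_isIntegral [CharZero k] (hϖ : Irreducible ϖ) (hN : N ≠ 0)
    (hx : x ^ N = algebraMap 𝒪 ks ϖ) {z : ks} (hz : z ∈ IntermediateField.adjoin k {x})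
    (hzi : IsIntegral 𝒪 z) : z ∈ Algebra.adjoin 𝒪 {x} := by
  have hxi := isIntegral_of_pow_eq hN hx
  have hxk : IsIntegral k x := hxi.tower_top
  have hfin : FiniteDimensional k (IntermediateField.adjoin k {x}) :=
    IntermediateField.adjoin.finiteDimensional hxk
  let φ : IntermediateField.adjoin k {x} →ₐ[𝒪] ks :=
    (IntermediateField.adjoin k {x}).val.restrictScalars 𝒪
  have hφ : Function.Injective φ := RingHom.injective φ.toRingHom
  let B := IntermediateField.adjoin.powerBasis hxk
  have hBφ : φ B.gen = x := by
    rw [IntermediateField.adjoin.powerBasis_gen]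
    exact IntermediateField.AdjoinSimple.coe_gen k x
  have hB : IsIntegral 𝒪 B.gen := by
    rw [← isIntegral_algHom_iff φ hφ, hBφ]
    exact hxi
  have hZ : IsIntegral 𝒪 (⟨z, hz⟩ : IntermediateField.adjoin k {x}) :=
    (isIntegral_algHom_iff φ hφ).1 hzi
  have hmin : minpoly 𝒪 B.gen = X ^ N - C ϖ := by
    refine map_injective (algebraMap 𝒪 k) (IsFractionRing.injective 𝒪 k) ?_
    rw [← minpoly.isIntegrallyClosed_eq_field_fractions' k hB, ← minpoly_eq_map_X_pow_sub_C hϖ hN hx]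
    refine Eq.trans ?_ (congrArg (minpoly k) hBφ)
    exact (minpoly.algHom_eq (IntermediateField.adjoin k {x}).val (RingHom.injective _) _).symm
  have hdisc := Algebra.discr_mul_isIntegral_mem_adjoin k hB hZ
  obtain ⟨d, hd⟩ := (IsIntegrallyClosed.isIntegral_iff (R := 𝒪)).1
    (Algebra.discr_isIntegral k (b := B.basis) fun i => by
      rw [B.basis_eq_pow]; exact hB.pow _)
  have hd0 : d ≠ 0 := by
    rintro rfl
    rw [map_zero] at hd
    exact Algebra.discr_not_zero_of_basis k B.basis hd.symm
  obtain ⟨n, u, hu⟩ := IsDiscreteValuationRing.eq_unit_mul_pow_irreducible hd0 hϖ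
  have h1 : ϖ ^ n • (⟨z, hz⟩ : IntermediateField.adjoin k {x}) ∈ Algebra.adjoin 𝒪 {B.gen} := by
    have h2 := Subalgebra.smul_mem _ hdisc (((u⁻¹ : 𝒪ˣ) : 𝒪))
    rw [← hd, algebraMap_smul, smul_smul, hu, ← mul_assoc, u.inv_mul, one_mul] at h2
    exact h2
  have h3 := mem_adjoin_of_smul_prime_pow_smul_of_minpoly_isEisensteinAt (K := k) hϖ.prime hB hZ h1
    (by rw [hmin]; exact isEisensteinAt_X_pow_sub_C hϖ hN)
  have h4 : φ ⟨z, hz⟩ ∈ (Algebra.adjoin 𝒪 {B.gen}).map φ := ⟨_, h3, rfl⟩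
  rw [AlgHom.map_adjoin, Set.image_singleton, hBφ] at h4
  exact h4

variable [CharZero k] [HenselianLocalRing 𝒪] [IsGalois k ks]

/-- The field generated by an `N`-th root of a uniformizer is totally ramified. -/
theorem exists_residue_eq_algebraMap (hϖ : Irreducible ϖ) (hN : N ≠ 0)
    (hx : x ^ N = algebraMap 𝒪 ks ϖ) (z : integralClosure 𝒪 ks)
    (hz : (z : ks) ∈ IntermediateField.adjoin k {x}) :
    ∃ a : BaseResidueField 𝒪,
      residue (integralClosure 𝒪 ks) z = algebraMap _ (SepResidueField 𝒪 ks) a := by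
  have h1 := mem_adjoin_of_isIntegral hϖ hN hx hz z.2
  rw [Algebra.adjoin_singleton_eq_range_aeval] at h1
  obtain ⟨p, hp⟩ := h1
  let x' : integralClosure 𝒪 ks := ⟨x, isIntegral_of_pow_eq hN hx⟩
  -- Modulo the maximal ideal `x` vanishes, so only the constant coefficient of a polynomial in `x`
  -- survives.
  have hx' : residue (integralClosure 𝒪 ks) x' = 0 := by
    rw [residue_eq_zero_iff]
    have h2 : x' ^ N = algebraMap 𝒪 (integralClosure 𝒪 ks) ϖ := Subtype.ext hx
    refine Ideal.IsPrime.mem_of_pow_mem inferInstance N ?_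
    rw [h2, mem_maximalIdeal, mem_nonunits_iff, isUnit_map_iff]
    exact hϖ.not_isUnit
  have hzp : z = aeval x' p := Subtype.ext (by
    rw [← hp]
    exact (aeval_algHom_apply (integralClosure 𝒪 ks).val x' p))
  refine ⟨residue 𝒪 (p.coeff 0), ?_⟩
  rw [hzp, ResidueField.algebraMap_residue, aeval_def, hom_eval₂, hx', eval₂_at_zero]
  rfl

/-- The integral elements fixed by `Gal(ks/k(x))` have residues in `k₀` by total ramification, so
this subgroup still surjects onto `Γ_k₀`. -/
theorem exists_apply_eq_self_and_toResidueGal_eq (hϖ : Irreducible ϖ) (hN : N ≠ 0)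
    (hx : x ^ N = algebraMap 𝒪 ks ϖ) (γ : ResidueGal 𝒪 ks) :
    ∃ τ : Gal(ks/k), τ x = x ∧ toResidueGal 𝒪 ks τ = γ := by
  let U := (IntermediateField.adjoin k {x}).fixingSubgroup
  have hfin : FiniteDimensional k (IntermediateField.adjoin k {x}) :=
    IntermediateField.adjoin.finiteDimensional (Algebra.IsIntegral.isIntegral x)
  have hU : IsClosed (U : Set Gal(ks/k)) := IntermediateField.fixingSubgroup_isClosed _
  have : CompactSpace U := isCompact_iff_compactSpace.1 hU.isCompact
  obtain ⟨τ, hτ⟩ := exists_smul_residue_eq (G := U) (B := integralClosure 𝒪 ks) (fun b => by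
      convert (isOpen_setOf_apply_mem (b : ks) {(b : ks)}).preimage
        (continuous_subtype_val (p := fun σ : Gal(ks/k) => σ ∈ U)) using 1
      ext g
      exact Subtype.ext_iff)
    (γ : SepResidueField 𝒪 ks ≃+* SepResidueField 𝒪 ks) (fun b hb => by
      have hb' : (b : ks) ∈ IntermediateField.adjoin k {x} := by
        rw [← InfiniteGalois.fixedField_fixingSubgroup (IntermediateField.adjoin k {x})]
        exact fun g => congrArg Subtype.val (hb g)
      obtain ⟨c, hc⟩ := exists_residue_eq_algebraMap hϖ hN hx b hb'
      rw [hc]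
      exact γ.commutes c)
  refine ⟨τ, τ.2 ⟨x, IntermediateField.mem_adjoin_simple_self k x⟩, AlgEquiv.ext fun b => ?_⟩
  obtain ⟨b, rfl⟩ := residue_surjective b
  exact hτ b

/-- By irreducibility `ζ * x` is a conjugate of `x`. An automorphism that realizes it is moved into
inertia by an element that fixes `x` and has the same image in `Γ_k₀`. -/
theorem exists_mem_inertia_apply_eq_mul (hϖ : Irreducible ϖ) (hN : N ≠ 0)
    (hx : x ^ N = algebraMap 𝒪 ks ϖ) {ζ : ks} (hζ : ζ ^ N = 1) :
    ∃ σ : Gal(ks/k), toResidueGal 𝒪 ks σ = 1 ∧ σ x = ζ * x := by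
  have hroot : aeval (ζ * x) (minpoly k x) = 0 := by
    rw [minpoly_eq_map_X_pow_sub_C hϖ hN hx, aeval_map_algebraMap]
    simp [mul_pow, hζ, hx]
  obtain ⟨σ, hσ⟩ := minpoly.exists_algEquiv_of_root' (Algebra.IsAlgebraic.isAlgebraic x) hroot
  obtain ⟨τ, hτx, hτ⟩ := exists_apply_eq_self_and_toResidueGal_eq hϖ hN hx (toResidueGal 𝒪 ks σ)
  refine ⟨σ * τ⁻¹, by rw [map_mul, map_inv, hτ, mul_inv_cancel], ?_⟩
  have h1 : τ⁻¹ x = x := by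
    nth_rw 1 [← hτx]
    rw [← AlgEquiv.mul_apply, inv_mul_cancel, AlgEquiv.one_apply]
  rw [AlgEquiv.mul_apply, h1, hσ]

theorem residueRatio_pow_eq_one (hx0 : x ≠ 0)
    (hx : x ^ N = algebraMap 𝒪 ks ϖ) (σ : Gal(ks/k)) : residueRatio 𝒪 x σ ^ N = 1 := by
  rw [residueRatio, ← map_pow, ← map_one (residue (integralClosure 𝒪 ks))]
  refine congrArg _ (Subtype.ext ?_)
  rw [Subalgebra.coe_pow, div_pow, ← map_pow, hx]
  have h1 : σ (algebraMap 𝒪 ks ϖ) = algebraMap 𝒪 ks ϖ := σ.commutes (ϖ : k)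
  rw [h1, ← hx]
  exact div_self (pow_ne_zero N hx0)

/-- A primitive `N`-th root of unity keeps its order under reduction, since `N` is nonzero in `k₀`.
-/
theorem exists_orderOf_residueRatio_eq [IsAlgClosed ks] (hϖ : Irreducible ϖ) (hN0 : N ≠ 0)
    (hN : (N : BaseResidueField 𝒪) ≠ 0) (hx0 : x ≠ 0) (hx : x ^ N = algebraMap 𝒪 ks ϖ) :
    ∃ σ : Gal(ks/k), toResidueGal 𝒪 ks σ = 1 ∧ orderOf (residueRatio 𝒪 x σ) = N := by
  have : CharZero ks := charZero_of_injective_algebraMap (algebraMap k ks).injective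
  have : NeZero (N : ks) := ⟨Nat.cast_ne_zero.2 hN0⟩
  obtain ⟨ζ, hζ⟩ := HasEnoughRootsOfUnity.exists_primitiveRoot ks N
  obtain ⟨σ, hσ, hσx⟩ := exists_mem_inertia_apply_eq_mul hϖ hN0 hx hζ.pow_eq_one
  refine ⟨σ, hσ, Nat.dvd_antisymm
    (orderOf_dvd_of_pow_eq_one (residueRatio_pow_eq_one hx0 hx σ)) ?_⟩
  let w : integralClosure 𝒪 ks := ⟨σ x / x, isIntegral_apply_div 𝒪 ks σ x⟩
  have hwζ : (w : ks) = ζ := by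
    change σ x / x = ζ
    rw [hσx, mul_div_cancel_right₀ _ hx0]
  have hw : w ^ orderOf (residueRatio 𝒪 x σ) = 1 := by
    refine eq_one_of_pow_eq_one_of_residue_eq_one hN ?_ ?_
    · refine Subtype.ext ?_
      push_cast
      rw [hwζ, ← pow_mul, mul_comm, pow_mul, hζ.pow_eq_one, one_pow]
    · rw [map_pow]
      exact pow_orderOf_eq_one (residueRatio 𝒪 x σ)
  refine (hζ.pow_eq_one_iff_dvd _).1 ?_
  have := congrArg Subtype.val hw
  push_cast at this
  rwa [hwζ] at this

end Eisenstein

theorem powCycloInv_map {k ks : Type*} [Field k] [Field ks] [Algebra k ks] [IsGalois k ks]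
    {𝒪 : ValuationSubring k} [HenselianLocalRing 𝒪] {G : Type*} [Group G] [Finite G] (γ : ResidueGal 𝒪 ks) (f : MulAut G)
    (g : G) : powCycloInv γ (f g) = f (powCycloInv γ g) := by
  -- The modulus enters the type of the character, so the equality of the two orders is used by
  -- substitution for variables.
  have key : ∀ (n m : ℕ) [NeZero n] [NeZero m], n = m →
      (modularCyclotomicCharacter' (SepResidueField 𝒪 ks) n
        (γ : SepResidueField 𝒪 ks ≃+* SepResidueField 𝒪 ks))⁻¹.val.val =
      (modularCyclotomicCharacter' (SepResidueField 𝒪 ks) m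
        (γ : SepResidueField 𝒪 ks ≃+* SepResidueField 𝒪 ks))⁻¹.val.val := by
    rintro n m _ _ rfl
    rfl
  have : NeZero (orderOf g) := ⟨(orderOf_pos g).ne'⟩
  have : NeZero (orderOf (f g)) := ⟨(orderOf_pos (f g)).ne'⟩
  rw [powCycloInv, powCycloInv, map_pow, key _ _ (MulEquiv.orderOf_eq f g)]

/-! ### Characters of tame inertia and the cyclotomic action. -/

section TameCharacter

variable {k ks : Type*} [Field k] [CharZero k] [Field ks] [Algebra k ks] [IsGalois k ks]
  {𝒪 : ValuationSubring k} [IsDiscreteValuationRing 𝒪] [HenselianLocalRing 𝒪] {x : ks}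

theorem residueRatio_eq_of_mk_eq (hx : x ≠ 0) {σ τ : Gal(ks/k)}
    (h : (σ : TameGal 𝒪 ks) = τ) : residueRatio 𝒪 x σ = residueRatio 𝒪 x τ := by
  have h1 : σ⁻¹ * τ ∈ wildInertia 𝒪 ks := QuotientGroup.eq.1 h
  have h2 := residueRatio_mul (𝒪 := 𝒪) hx σ (σ⁻¹ * τ)
  rw [mul_inv_cancel_left, (residueRatio_eq_one_iff hx _).2 (h1 x), map_one, mul_one] at h2
  exact h2.symm

/-- The homomorphism on tame inertia given by the residue of `σ x / x`. -/
def tameCharacter (𝒪 : ValuationSubring k) [IsDiscreteValuationRing 𝒪] [HenselianLocalRing 𝒪]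
    (hx : x ≠ 0) : TameInertia 𝒪 ks →* (SepResidueField 𝒪 ks)ˣ :=
  MonoidHom.toHomUnits
    { toFun := fun q => Quotient.liftOn' q.1 (residueRatio 𝒪 x) fun σ τ h =>
        residueRatio_eq_of_mk_eq hx (Quotient.sound' h)
      map_one' := residueRatio_one hx
      map_mul' := by
        rintro ⟨p, hp⟩ ⟨q, hq⟩
        obtain ⟨σ, rfl⟩ := QuotientGroup.mk_surjective p
        obtain ⟨τ, rfl⟩ := QuotientGroup.mk_surjective q
        have hσ : toResidueGal 𝒪 ks σ = 1 := hp
        change residueRatio 𝒪 x (σ * τ) = residueRatio 𝒪 x σ * residueRatio 𝒪 x τ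
        rw [residueRatio_mul hx, hσ, AlgEquiv.one_apply] }

theorem tameCharacter_mk (hx : x ≠ 0) (q : TameInertia 𝒪 ks) (σ : Gal(ks/k))
    (h : (q : TameGal 𝒪 ks) = σ) :
    (tameCharacter 𝒪 hx q : SepResidueField 𝒪 ks) = residueRatio 𝒪 x σ := by
  obtain ⟨q, hq⟩ := q
  subst h
  rfl

/-- This plays the role of continuity, for a target regarded as discrete. -/
theorem isOpen_preimage_tameCharacter (hx : x ≠ 0) (S : Set (SepResidueField 𝒪 ks)ˣ) :
    IsOpen (tameCharacter 𝒪 hx ⁻¹' S) := by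
  have h1 : IsOpen {q : TameGal 𝒪 ks | Quotient.liftOn' q (residueRatio 𝒪 x)
      (fun σ τ h => residueRatio_eq_of_mk_eq hx (Quotient.sound' h)) ∈ Units.val '' S} := by
    refine isOpen_coinduced.2 ?_
    convert isOpen_setOf_apply_mem (k := k) x {z | ∃ h : IsIntegral 𝒪 (z / x),
      residue (integralClosure 𝒪 ks) ⟨z / x, h⟩ ∈ Units.val '' S} using 1
    ext σ
    exact ⟨fun h => ⟨isIntegral_apply_div 𝒪 ks σ x, h⟩, fun ⟨_, h⟩ => h⟩
  convert h1.preimage continuous_subtype_val using 1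
  ext q
  constructor
  · exact fun h => ⟨_, h, rfl⟩
  · rintro ⟨z, hz, hzq⟩
    have h2 : z = tameCharacter 𝒪 hx q := Units.ext hzq
    rw [Set.mem_preimage, ← h2]
    exact hz

/-- The crossed homomorphism rule is applied to `τ⁻¹ * (σ * τ)`. As `σ` acts trivially on residues,
the ratios of `τ⁻¹` and `τ` cancel, and the ratio of `σ` is left, moved by `τ⁻¹`. -/
theorem tameCharacter_conjNormal (hx : x ≠ 0) (g : TameGal 𝒪 ks) (q : TameInertia 𝒪 ks) :
    (tameCharacter 𝒪 hx (MulAut.conjNormal g⁻¹ q) : SepResidueField 𝒪 ks) =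
      (tameToResidueGal 𝒪 ks g)⁻¹ (tameCharacter 𝒪 hx q : SepResidueField 𝒪 ks) := by
  obtain ⟨τ, rfl⟩ := QuotientGroup.mk_surjective g
  obtain ⟨σ, hσ⟩ := QuotientGroup.mk_surjective (q : TameGal 𝒪 ks)
  have hσ1 : toResidueGal 𝒪 ks σ = 1 := by
    have : tameToResidueGal 𝒪 ks q = 1 := q.2
    rw [← hσ] at this
    exact this
  rw [tameCharacter_mk hx q σ hσ.symm, tameCharacter_mk hx _ (τ⁻¹ * (σ * τ)) (by
    rw [MulAut.conjNormal_apply, ← hσ, inv_inv, mul_assoc]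
    rfl)]
  change _ = (toResidueGal 𝒪 ks τ)⁻¹ _
  rw [residueRatio_mul hx, residueRatio_mul hx σ, hσ1, AlgEquiv.one_apply, map_mul, map_inv,
    mul_left_comm, ← map_inv, ← residueRatio_mul hx, inv_mul_cancel, residueRatio_one hx, mul_one]

theorem eq_top_of_isClosed_of_mem {P : Type*} [Group P] [TopologicalSpace P] [IsTopologicalGroup P]
    {q₀ : P} (hq₀ : (Subgroup.zpowers q₀).topologicalClosure = ⊤) (S : Subgroup P)
    (hS : IsClosed (S : Set P)) (h : q₀ ∈ S) (q : P) : q ∈ S := by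
  have h1 : (Subgroup.zpowers q₀).topologicalClosure ≤ S :=
    Subgroup.topologicalClosure_minimal _ (by rwa [Subgroup.zpowers_le]) hS
  rw [hq₀] at h1
  exact h1 (Subgroup.mem_top q)

theorem hom_ext_of_topologicalClosure_zpowers_eq_top {P A : Type*} [Group P] [TopologicalSpace P]
    [IsTopologicalGroup P] [Group A] [TopologicalSpace A] [T2Space A]
    {q₀ : P} (hq₀ : (Subgroup.zpowers q₀).topologicalClosure = ⊤) {f g : P →ₜ* A}
    (h : f q₀ = g q₀) (q : P) : f q = g q :=
  eq_top_of_isClosed_of_mem hq₀ (f.toMonoidHom.eqLocus g.toMonoidHom)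
    (isClosed_eq f.continuous_toFun g.continuous_toFun) h q

variable [IsSepClosure k ks]

/-- Tame inertia has homomorphisms with prescribed value at a topological generator, and conjugation
acts on them through the cyclotomic character. -/
theorem exists_hom_tameInertia {q₀ : TameInertia 𝒪 ks}
    (hq₀ : (Subgroup.zpowers q₀).topologicalClosure = ⊤) {H : Type*} [Group H] [Finite H]
    [TopologicalSpace H] (g : H) (hg : (orderOf g : BaseResidueField 𝒪) ≠ 0) :
    ∃ α : TameInertia 𝒪 ks →ₜ* H, α q₀ = g ∧ ∀ t : TameGal 𝒪 ks,
      α (MulAut.conjNormal t⁻¹ q₀) = powCycloInv (tameToResidueGal 𝒪 ks t) g := by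
  have : CharZero ks := charZero_of_injective_algebraMap (algebraMap k ks).injective
  have : IsSepClosed ks := IsSepClosure.sep_closed k
  have : IsAlgClosed ks := inferInstance
  have hN : orderOf g ≠ 0 := (orderOf_pos g).ne'
  obtain ⟨ϖ, hϖ⟩ := IsDiscreteValuationRing.exists_irreducible 𝒪
  obtain ⟨x, hx⟩ := IsAlgClosed.exists_pow_nat_eq (algebraMap 𝒪 ks ϖ) (orderOf_pos g)
  have hx0 : x ≠ 0 := by
    rintro rfl
    rw [zero_pow hN] at hx
    have h1 : algebraMap k ks ϖ = 0 := hx.symm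
    rw [map_eq_zero] at h1
    exact hϖ.ne_zero (Subtype.ext h1)
  set θ := tameCharacter 𝒪 hx0 with hθ
  -- The powers of `q₀` are dense and the preimage of this subgroup is closed.
  have hgen : ∀ q, θ q ∈ Subgroup.zpowers (θ q₀) :=
    eq_top_of_isClosed_of_mem hq₀ ((Subgroup.zpowers (θ q₀)).comap θ)
      ⟨isOpen_preimage_tameCharacter hx0
        ((Subgroup.zpowers (θ q₀) : Set (SepResidueField 𝒪 ks)ˣ)ᶜ)⟩
      (Subgroup.mem_zpowers (θ q₀))
  have hθpow : θ q₀ ^ orderOf g = 1 := by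
    obtain ⟨σ, hσ⟩ := QuotientGroup.mk_surjective (q₀ : TameGal 𝒪 ks)
    refine Units.ext ?_
    rw [Units.val_pow_eq_pow_val, hθ, tameCharacter_mk hx0 q₀ σ hσ.symm,
      residueRatio_pow_eq_one hx0 hx, Units.val_one]
  -- Some value of `θ` has order exactly `orderOf g`, and all values are powers of `θ q₀`. The
  -- divisibility allows the assignment `θ q₀ ↦ g` to extend to a homomorphism.
  have hord : orderOf g ∣ orderOf (θ q₀) := by
    obtain ⟨σ, hσ1, hσ⟩ := exists_orderOf_residueRatio_eq hϖ hN hg hx0 hx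
    have h1 : orderOf (θ ⟨(σ : TameGal 𝒪 ks), hσ1⟩) = orderOf g := by
      rw [← orderOf_units, hθ, tameCharacter_mk hx0 _ σ rfl, hσ]
    rw [← h1]
    exact orderOf_dvd_of_mem_zpowers (hgen _)
  let z₀ : Subgroup.zpowers (θ q₀) := ⟨θ q₀, Subgroup.mem_zpowers _⟩
  have hz₀ : ∀ z, z ∈ Subgroup.zpowers z₀ := by
    rintro ⟨z, n, rfl⟩
    exact ⟨n, Subtype.ext rfl⟩
  let f : Subgroup.zpowers (θ q₀) →* H := monoidHomOfForallMemZpowers hz₀ (g' := g) (by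
    rwa [← Subgroup.orderOf_coe])
  have hf : f z₀ = g := monoidHomOfForallMemZpowers_apply_gen _ _
  let α : TameInertia 𝒪 ks →ₜ* H :=
    { toMonoidHom := f.comp (θ.codRestrict _ hgen)
      continuous_toFun := ⟨fun S _ => by
        convert isOpen_preimage_tameCharacter hx0 (Subtype.val '' (f ⁻¹' S)) using 1
        ext q
        constructor
        · exact fun h => ⟨_, h, rfl⟩
        · rintro ⟨z, hz, hzq⟩
          have h1 : z = θ.codRestrict _ hgen q := Subtype.ext hzq
          rw [h1] at hz
          exact hz⟩ }
  refine ⟨α, hf, fun t => ?_⟩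
  have : NeZero (orderOf g) := ⟨hN⟩
  set e := (modularCyclotomicCharacter' (SepResidueField 𝒪 ks) (orderOf g)
    ((tameToResidueGal 𝒪 ks t : SepResidueField 𝒪 ks ≃+* SepResidueField 𝒪 ks))⁻¹).val.val with he
  -- Conjugation acts on `θ q₀` through the inverse of the residue automorphism; `θ q₀` is a root of
  -- unity of order dividing `orderOf g`, so this is the power with exponent `χ⁻¹`.
  have h1 : θ (MulAut.conjNormal t⁻¹ q₀) = θ q₀ ^ e := by
    refine Units.ext ?_
    rw [hθ, tameCharacter_conjNormal, ← hθ, Units.val_pow_eq_pow_val]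
    exact modularCyclotomicCharacter'.spec' (SepResidueField 𝒪 ks) (n := orderOf g)
      ((tameToResidueGal 𝒪 ks t : SepResidueField 𝒪 ks ≃+* SepResidueField 𝒪 ks))⁻¹
      ((mem_rootsOfUnity _ _).2 hθpow)
  have h2 : θ.codRestrict _ hgen (MulAut.conjNormal t⁻¹ q₀) = z₀ ^ e := Subtype.ext h1
  change f (θ.codRestrict _ hgen (MulAut.conjNormal t⁻¹ q₀)) = _
  rw [h2, map_pow, hf, he, map_inv]
  rfl

end TameCharacter

end TameResidue

end

/-! ### The residue formula and the descent of the obstruction. -/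

theorem mainTheorem5 {k ks : Type*} [Field k] [CharZero k] [Field ks] [Algebra k ks]
    [IsSepClosure k ks] (𝒪 : ValuationSubring k) [IsDiscreteValuationRing 𝒪]
    [HenselianLocalRing 𝒪] [PerfectField (BaseResidueField 𝒪)]
    (s : ResidueGal 𝒪 ks →ₜ* TameGal 𝒪 ks) (hs : ∀ γ, tameToResidueGal 𝒪 ks (s γ) = γ)
    {G : Type*} [Group G] [Finite G] [TopologicalSpace G] [DiscreteTopology G]
    (hC : (Nat.card (Subgroup.center G) : BaseResidueField 𝒪) ≠ 0)
    (φ : Gal(ks/k) →ₜ* G ⧸ Subgroup.center G) (hφ : ∀ σ ∈ wildInertia 𝒪 ks, φ σ = 1)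
    (q₀ : TameInertia 𝒪 ks) (hq₀ : (Subgroup.zpowers q₀).topologicalClosure = ⊤)
    (a₀ : G) (ha₀ : (a₀ : G ⧸ Subgroup.center G) = tameLift 𝒪 ks φ hφ q₀) :
    Function.Bijective (fun η : NegTwist 𝒪 ks (Subgroup.center G) => η q₀) ∧
    (∃ c : Z1 (negTwistAction s (Subgroup.center G)),
      (∀ γ, ((c.1 γ q₀ : Subgroup.center G) : G) =
        cocycleElement ((tameLift 𝒪 ks φ hφ).comp s) a₀ γ) ∧
      IsResidue s (obstruction φ) (QuotientGroup.mk c) ∧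
      residueMap s (obstruction φ) = QuotientGroup.mk c) ∧
    (residueMap s (obstruction φ) = 1 →
      ∃ ω₀ : H2 (ResidueGal 𝒪 ks) (Subgroup.center G),
        H2.pullback (toResidueGal 𝒪 ks) ω₀ = obstruction φ ∧
        (∀ ω₁, H2.pullback (toResidueGal 𝒪 ks) ω₁ = obstruction φ → ω₁ = ω₀) ∧
        ω₀ = obstruction ((tameLift 𝒪 ks φ hφ).comp s) ∧
        (ω₀ = 1 ↔ ∃ ψ : ResidueGal 𝒪 ks →ₜ* G,
          ∀ γ, (ψ γ : G ⧸ Subgroup.center G) = tameLift 𝒪 ks φ hφ (s γ))) := by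
  have hdisc : DiscreteTopology (G ⧸ Subgroup.center G) :=
    QuotientGroup.discreteTopology (isOpen_discrete _)
  set φt := tameLift 𝒪 ks φ hφ with hφt
  set π := tameToResidueGal 𝒪 ks with hπ
  have hφcomp : obstruction φ = H2.pullback (toTameGal 𝒪 ks) (obstruction φt) :=
    obstruction_comp φt (toTameGal 𝒪 ks)
  have hinf : Function.Injective (H2.pullback (toTameGal 𝒪 ks) :
      H2 (TameGal 𝒪 ks) (Subgroup.center G) →* H2 Gal(ks/k) (Subgroup.center G)) :=
    H2.inflation_injective (wildInertia 𝒪 ks) (toTameGal 𝒪 ks) (fun _ => rfl)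
      (hom_wildInertia_eq_one 𝒪 ks hC)
  have hdvd : ∀ {m n : ℕ}, m ∣ n → (n : BaseResidueField 𝒪) ≠ 0 →
      (m : BaseResidueField 𝒪) ≠ 0 := by
    rintro m _ ⟨c, rfl⟩ h h0
    rw [Nat.cast_mul, h0, zero_mul] at h
    exact h rfl
  -- The image of `q₀` in `G / Z(G)` is killed by some `m` prime to the residue characteristic. Then
  -- `a₀ ^ m` is central, and the order of the center is prime to it as well.
  have hord : (orderOf a₀ : BaseResidueField 𝒪) ≠ 0 := by
    obtain ⟨σ, hσ⟩ := QuotientGroup.mk_surjective (q₀ : TameGal 𝒪 ks)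
    have hσ1 : toResidueGal 𝒪 ks σ = 1 := by
      have h1 : π (q₀ : TameGal 𝒪 ks) = 1 := q₀.2
      rw [← hσ] at h1
      exact h1
    obtain ⟨m, hm, hm'⟩ := exists_pow_eq_one_of_toResidueGal_eq_one φ hφ hσ1
    have h2 : a₀ ^ m ∈ Subgroup.center G := by
      rw [← QuotientGroup.eq_one_iff, QuotientGroup.mk_pow, ha₀, ← hσ]
      exact hm'
    have h3 : a₀ ^ (m * Nat.card (Subgroup.center G)) = 1 := by
      rw [pow_mul]
      exact congrArg Subtype.val (pow_card_eq_one' (x := (⟨_, h2⟩ : Subgroup.center G)))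
    exact hdvd (orderOf_dvd_of_pow_eq_one h3) (by rw [Nat.cast_mul]; exact mul_ne_zero hm hC)
  obtain ⟨α, hα₀, hαc⟩ := exists_hom_tameInertia hq₀ a₀ hord
  have hα : ∀ n, (α n : G ⧸ Subgroup.center G) = φt n := by
    let f : TameInertia 𝒪 ks →ₜ* G ⧸ Subgroup.center G :=
      { toMonoidHom := (QuotientGroup.mk' _).comp α.toMonoidHom
        continuous_toFun := QuotientGroup.continuous_mk.comp α.continuous_toFun }
    let f' : TameInertia 𝒪 ks →ₜ* G ⧸ Subgroup.center G :=
      { toMonoidHom := φt.toMonoidHom.comp (TameInertia 𝒪 ks).subtype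
        continuous_toFun := φt.continuous_toFun.comp continuous_subtype_val }
    exact hom_ext_of_topologicalClosure_zpowers_eq_top hq₀ (f := f) (g := f')
      ((congrArg QuotientGroup.mk hα₀).trans ha₀)
  -- Division by the chosen representative of `1`, which is central, normalizes the lift to `u 1 =
  -- 1`.
  let u : ResidueGal 𝒪 ks → G := fun γ =>
    (φt (s γ)).out * (Quotient.out (1 : G ⧸ Subgroup.center G))⁻¹
  have hu : Continuous u := (continuous_of_discreteTopology (f := fun g : G ⧸ Subgroup.center G =>
    g.out * (Quotient.out (1 : G ⧸ Subgroup.center G))⁻¹)).comp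
      (φt.continuous_toFun.comp s.continuous_toFun)
  have hu1 : u 1 = 1 := by
    change (φt (s 1)).out * _ = 1
    rw [map_one, map_one, mul_inv_cancel]
  have huφ : ∀ γ, (u γ : G ⧸ Subgroup.center G) = φt (s γ) := fun γ => by
    have h1 : ∀ g : G ⧸ Subgroup.center G, (g.out : G ⧸ Subgroup.center G) = g :=
      fun g => Quotient.out_eq' g
    change (((φt (s γ)).out * _ : G) : G ⧸ Subgroup.center G) = _
    rw [QuotientGroup.mk_mul, QuotientGroup.mk_inv, h1, h1, inv_one, mul_one]
  obtain ⟨a, ha, hmk, hval⟩ := exists_isAdapted_obstruction π s hs φt u hu hu1 huφ α hα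
  let c : Z1 (negTwistAction s (Subgroup.center G)) := residueCocycle π s a ha
  have hc : ∀ γ n, ((c.1 γ n : Subgroup.center G) : G) =
      α n * u γ * (α (MulAut.conjNormal (s γ)⁻¹ n))⁻¹ * (u γ)⁻¹ := fun γ n => by
    have h1 := hval 1 n γ
    rw [map_one, one_mul, hu1, one_mul, one_mul] at h1
    exact h1
  have hres : IsResidue s (obstruction φ) (QuotientGroup.mk c) :=
    ⟨a, ha, by rw [hφcomp, hmk], rfl⟩
  have hmap : residueMap s (obstruction φ) = QuotientGroup.mk c := by
    have hex : ∃ β, IsResidue s (obstruction φ) β := ⟨_, hres⟩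
    rw [residueMap, dif_pos hex]
    -- The residue picked by choice may come from another adapted cocycle. Injectivity of inflation
    -- puts both cocycles in one class on `Γ_k^t`.
    obtain ⟨a', ha', hmk', hβ⟩ := hex.choose_spec
    rw [← hβ]
    exact residueCocycle_mk_eq π s a' a ha' ha (hinf (by rw [hmk', hφcomp, hmk]))
  refine ⟨⟨fun η η' h => ?_, fun z => ?_⟩, ⟨c, fun γ => ?_, hres, hmap⟩, fun h1 => ?_⟩
  · exact ContinuousMonoidHom.ext (hom_ext_of_topologicalClosure_zpowers_eq_top hq₀ h)
  · obtain ⟨η, hη, -⟩ := exists_hom_tameInertia hq₀ z (hdvd (orderOf_dvd_natCard z) hC)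
    exact ⟨η, hη⟩
  · have h1 : conjAction G (φt (s γ)) = MulAut.conj (u γ) := by
      rw [← huφ]
      rfl
    rw [hc, hα₀, hαc, hs, cocycleElement]
    change _ = a₀ * (powCycloInv γ (conjAction G (φt (s γ)) a₀))⁻¹
    rw [h1, powCycloInv_map, MulAut.conj_apply]
    group
  · rw [hmap, QuotientGroup.eq_one_iff] at h1
    obtain ⟨η, hη⟩ := h1
    have hcomm : ∀ n g, g * (η n : G) = η n * g := fun n g => Subgroup.mem_center_iff.1 (η n).2 g
    -- Multiplying `α` by `η` divides its residue cocycle by the coboundary of `η`, so the new one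
    -- is identically `1`.
    let α' : TameInertia 𝒪 ks →ₜ* G :=
      { toFun := fun n => α n * η n
        map_one' := by simp
        map_mul' := fun n m => by
          rw [map_mul, map_mul, Subgroup.coe_mul, mul_assoc, ← mul_assoc (α m), hcomm n (α m)]
          simp only [mul_assoc]
        continuous_toFun := α.continuous_toFun.mul
          (continuous_subtype_val.comp η.continuous_toFun) }
    have hα' : ∀ n, (α' n : G ⧸ Subgroup.center G) = φt n := fun n => by
      rw [← hα]
      exact QuotientGroup.mk_mul_of_mem _ (η n).2
    have hpull : obstruction φt = H2.pullback π (obstruction (φt.comp s)) := by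
      refine obstruction_eq_pullback π s hs φt u hu hu1 huφ α' hα' fun m γ => ?_
      set m' := MulAut.conjNormal (s γ)⁻¹ m with hm'
      have h2 : ((c.1 γ m : Subgroup.center G) : G) = η m' * (η m : G)⁻¹ := by
        have h3 : c.1 γ m = η m' / η m :=
          DFunLike.congr_fun (hη γ) m
        rw [h3, div_eq_mul_inv]
        rfl
      have h4 : α m * u γ * (α m')⁻¹ = η m' * (η m : G)⁻¹ * u γ := by
        rw [← h2, hc, inv_mul_cancel_right]
      have hcomm' : ∀ n g, g * (η n : G)⁻¹ = (η n : G)⁻¹ * g := fun n g =>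
        Subgroup.mem_center_iff.1 (inv_mem (η n).2) g
      change α m * η m * u γ * (α m' * η m')⁻¹ = u γ
      rw [mul_inv_rev, hcomm m, ← hcomm' m']
      calc _ = η m * (α m * u γ * (α m')⁻¹) * (η m' : G)⁻¹ := by simp only [mul_assoc]
        _ = u γ := by
          rw [h4, hcomm' m', hcomm' m]
          group
    have hinj : Function.Injective (H2.pullback (toResidueGal 𝒪 ks) :
        H2 (ResidueGal 𝒪 ks) (Subgroup.center G) →* H2 Gal(ks/k) (Subgroup.center G)) := by
      intro ω ω' h
      refine H2.pullback_injective_of_section π s hs (hinf ?_)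
      rw [H2.pullback_comp, H2.pullback_comp]
      exact h
    have hω : H2.pullback (toResidueGal 𝒪 ks) (obstruction (φt.comp s)) = obstruction φ := by
      rw [hφcomp, hpull, H2.pullback_comp]
      rfl
    exact ⟨_, hω, fun ω₁ h => hinj (h.trans hω.symm), rfl, obstruction_eq_one_iff _⟩
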